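/- Let $S^3$ be the three-sphere, viewed as the group of unit quaternions, with its standard smooth structure. By a Ricci flow with extinction time $T\in(0,\infty)$ on $S^3$ we mean a family $(g(t))_{t\in[0,T)}$ of smooth Riemannian metrics on $S^3$, smooth on $[0,T)\times S^3$, solving $\partial_t g(t)=-2\,\mathrm{Ric}(g(t))$, which does not extend to a Ricci flow on $[0,T')$ for any $T'>T$. It is called homogeneous if for every $t\in[0,T)$ the isometry group of $(S^3,g(t))$ acts transitively on $S^3$. $\Vert \mathrm{Rm}(g)\Vert$ denotes the pointwise tensor norm of the Riemannian curvature tensor, $\Vert \mathrm{Rm}\Vert^2=\sum_{i,j,k,l}R_{ijkl}^2$ in an orthonormal basis, and $\mathrm{scal}(g)$ the scalar curvature. (1) There exist numbers $T(l)\in(0,\infty)$, $l\in\mathbb{N}$, and homogeneous Ricci flows $(g_l(t))_{t\in[0,T(l))}$ on $S^3$ with extinction time $T(l)$, all of whose metrics $g_l(t)$ are moreover left-invariant, such that $\Vert \mathrm{Rm}(g_l(0))\Vert = 1$ and $\mathrm{scal}(g_l(0))>0$ on $S^3$ for all $l$, and $T(l)\to\infty$ as $l\to\infty$. (2) Hence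 there is no uniform Type I bound for small times: for every $\delta\in(0,1)$ there is no constant $C$ such that every homogeneous Ricci flow $(g(t))_{t\in[0,T)}$ on $S^3$ with extinction time $T<\infty$ and $\mathrm{scal}(g(0))>0$ satisfies $\Vert \mathrm{Rm}(g(t))\Vert\cdot (T-t)\le C$ for all $t\in[0,\delta T)$ (at all points of $S^3$). -/

import Mathlib

open Bundle Set Filter Topology Module
open scoped Manifold ContDiff Quaternion

noncomputable section

/-- A finite-dimensional real vector space with an inner product has an orthonormal basis. -/
theorem exists_basis_of_core {V : Type*} [AddCommGroup V] [Module ℝ V]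
    (hV : FiniteDimensional ℝ V) (c : InnerProductSpace.Core ℝ V) :
    ∃ e : Basis (Fin (finrank ℝ V)) ℝ V, ∀ i j, c.inner (e i) (e j) = if i = j then 1 else 0 := by
  let n : NormedAddCommGroup V := c.toNormedAddCommGroup
  let p : InnerProductSpace ℝ V := InnerProductSpace.ofCore c.toCore
  let b := stdOrthonormalBasis ℝ V
  refine ⟨b.toBasis, fun i j ↦ ?_⟩
  rw [OrthonormalBasis.coe_toBasis]
  exact orthonormal_iff_ite.1 b.orthonormal i j

section Riemannian

variable {E : Type*} [NormedAddCommGroup E] [NormedSpace ℝ E] [FiniteDimensional ℝ E]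
  {H : Type*} [TopologicalSpace H] {I : ModelWithCorners ℝ E H}
  {M : Type*} [TopologicalSpace M] [ChartedSpace H M] [IsManifold I ∞ M]

variable (I M) in
/-- Smooth Riemannian metrics on the manifold `M`. -/
abbrev SmoothMetric : Type _ :=
  ContMDiffRiemannianMetric I ∞ E (TangentSpace I : M → Type _)

variable (I M) in
/-- Vector fields on `M` (with no regularity imposed). -/
abbrev VField : Type _ := Π x : M, TangentSpace I x

/-- `cov` is the Levi-Civita connection of the metric `g`: an affine connection that is
torsion-free and compatible with `g`, that is, `v g(Y,Z) = g(∇_v Y, Z) + g(Y, ∇_v Z)`.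
Here `cov Y x v` is `(∇_v Y)(x)`. -/
structure IsLeviCivita (g : SmoothMetric I M)
    (cov : CovariantDerivative I E (TangentSpace I : M → Type _)) : Prop where
  torsion_eq_zero : cov.torsion = 0
  compatible : ∀ (Y Z : VField I M) (x : M), MDiffAt (T% Y) x → MDiffAt (T% Z) x →
    ∀ v : TangentSpace I x, d% (fun y ↦ g.inner y (Y y) (Z y)) x v =
      g.inner x (cov Y x v) (Z x) + g.inner x (Y x) (cov Z x v)

open scoped Classical in
/-- The Levi-Civita connection of `g`; `leviCivita g Y x v` is `(∇_v Y)(x)`.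
(By the fundamental theorem of Riemannian geometry it exists and is unique on differentiable
fields, so the `else` branch is never used.) -/
def leviCivita (g : SmoothMetric I M) :
    VField I M → Π x : M, TangentSpace I x →L[ℝ] TangentSpace I x :=
  if h : ∃ cov, IsLeviCivita g cov then h.choose.toFun else fun _ _ ↦ 0

/-- The curvature `R(X,Y)Z = ∇_X ∇_Y Z - ∇_Y ∇_X Z - ∇_[X,Y] Z` of the Levi-Civita connection,
on vector fields. -/
def curvatureField (g : SmoothMetric I M) (X Y Z : VField I M) : VField I M := fun x ↦
  leviCivita g (fun y ↦ leviCivita g Z y (Y y)) x (X x)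
    - leviCivita g (fun y ↦ leviCivita g Z y (X y)) x (Y x)
    - leviCivita g Z x (VectorField.mlieBracket I X Y x)

/-- The curvature tensor at a point, `R(u,v)w ∈ T_xM`, computed by means of extensions of
`u, v, w` to vector fields that are smooth near `x` (it does not depend on the extensions). -/
def curvature (g : SmoothMetric I M) (x : M) (u v w : TangentSpace I x) : TangentSpace I x :=
  curvatureField g (FiberBundle.extend E u) (FiberBundle.extend E v) (FiberBundle.extend E w) x

/-- `T_xM` has a `g`-orthonormal basis. -/
theorem exists_orthonormalFrame (g : SmoothMetric I M) (x : M) :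
    ∃ e : Basis (Fin (finrank ℝ E)) ℝ (TangentSpace I x),
      ∀ i j, g.inner x (e i) (e j) = if i = j then 1 else 0 :=
  exists_basis_of_core (V := TangentSpace I x) (inferInstanceAs (FiniteDimensional ℝ E))
    (g.toRiemannianMetric.toCore x)

/-- A `g`-orthonormal basis of `T_xM`. -/
def orthonormalFrame (g : SmoothMetric I M) (x : M) :
    Basis (Fin (finrank ℝ E)) ℝ (TangentSpace I x) :=
  (exists_orthonormalFrame g x).choose

theorem inner_orthonormalFrame (g : SmoothMetric I M) (x : M) (i j : Fin (finrank ℝ E)) :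
    g.inner x (orthonormalFrame g x i) (orthonormalFrame g x j) = if i = j then 1 else 0 :=
  (exists_orthonormalFrame g x).choose_spec i j

/-- The norm of the curvature tensor at `x`:
`‖Rm‖² = ∑ R_ijkl²` in a `g`-orthonormal basis, where `R_ijkl = g(R(e_i,e_j)e_k, e_l)`. -/
def normRm (g : SmoothMetric I M) (x : M) : ℝ :=
  let e := orthonormalFrame g x
  √(∑ i, ∑ j, ∑ k, ∑ l, (g.inner x (curvature g x (e i) (e j) (e k)) (e l)) ^ 2)

/-- The Ricci tensor `Ric(v,w) = tr (u ↦ R(u,v)w)`. -/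
def ricci (g : SmoothMetric I M) (x : M) (v w : TangentSpace I x) : ℝ :=
  let e := orthonormalFrame g x
  ∑ i, g.inner x (curvature g x (e i) v w) (e i)

/-- The scalar curvature, the `g`-trace of the Ricci tensor. -/
def scal (g : SmoothMetric I M) (x : M) : ℝ :=
  let e := orthonormalFrame g x
  ∑ i, ricci g x (e i) (e i)

/-- `g` is (globally) homogeneous: its isometry group acts transitively on `M`. -/
def IsHomogeneous (g : SmoothMetric I M) : Prop :=
  ∀ p q : M, ∃ f : M ≃ₘ^∞⟮I, I⟯ M, f p = q ∧ ∀ (x : M) (v w : TangentSpace I x),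
    g.inner (f x) (mfderiv I I f x v) (mfderiv I I f x w) = g.inner x v w

/-- `(g t)`, `t ∈ [0,T)`, is a solution of the Ricci flow `∂g/∂t = -2 Ric(g)` on `M`, smooth on
`[0,T) × M`. The values of `g` outside `[0,T)` are irrelevant. -/
structure IsRicciFlow (g : ℝ → SmoothMetric I M) (T : ℝ) : Prop where
  smooth : ∀ X Y : VField I M,
    ContMDiff I I.tangent ∞ (fun x ↦ (X x : TangentBundle I M)) →
    ContMDiff I I.tangent ∞ (fun x ↦ (Y x : TangentBundle I M)) →
    ContMDiffOn (𝓘(ℝ, ℝ).prod I) 𝓘(ℝ, ℝ) ∞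
      (fun p : ℝ × M ↦ (g p.1).inner p.2 (X p.2) (Y p.2)) (Ico 0 T ×ˢ univ)
  evolution : ∀ t ∈ Ico 0 T, ∀ (x : M) (v w : TangentSpace I x),
    HasDerivWithinAt (fun s ↦ (g s).inner x v w) (-2 * ricci (g t) x v w) (Ico 0 T) t

/-- `(g t)`, `t ∈ [0,T)`, is a Ricci flow with (finite) extinction time `T > 0`: it does not extend
to a Ricci flow on a longer time interval. -/
structure HasExtinctionTime (g : ℝ → SmoothMetric I M) (T : ℝ) : Prop where
  pos : 0 < T
  flow : IsRicciFlow g T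
  maximal : ¬ ∃ T' > T, ∃ g' : ℝ → SmoothMetric I M,
    IsRicciFlow g' T' ∧ ∀ t ∈ Ico 0 T, g' t = g t

end Riemannian

section Sphere

instance fact_finrank_quaternion : Fact (finrank ℝ ℍ[ℝ] = 3 + 1) :=
  ⟨Quaternion.finrank_eq_four⟩

/-- The three-sphere, as the unit sphere of the quaternions, with its standard smooth structure.
It is a group under quaternion multiplication. -/
abbrev S3 : Type := Metric.sphere (0 : ℍ[ℝ]) 1

/-- Invariance of a metric on `S³` under all left translations of the group of unit
quaternions. -/
def IsLeftInvariant (g : SmoothMetric (𝓡 3) S3) : Prop :=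
  ∀ (a x : S3) (v w : TangentSpace (𝓡 3) x),
    g.inner (a * x) (mfderiv (𝓡 3) (𝓡 3) (fun y : S3 ↦ a * y) x v)
      (mfderiv (𝓡 3) (𝓡 3) (fun y : S3 ↦ a * y) x w) = g.inner x v w

end Sphere

end

/-! The examples are the left-invariant metrics `∑ aᵢ θᵢ²`, with `θᵢ` dual to the left-invariant
frame extending `i, j, k`. Their Ricci tensor is diagonal in the same frame, so a positive solution
of an autonomous ODE for `(a₀, a₁, a₂)` is a Ricci flow.

Long life: the order `a₀ > a₁ > a₂` is preserved, and it forces `a₀' ≤ -4` and `a₁' ≥ -8`. The first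
bound makes the life span finite. By the second, `a₁` stays away from `0` before time `a₁(0)/8`.
Then `a₂` decays at most exponentially, so the solution stays in a compact part of the positive cone
and continues (`IsSolutionOn.le_lifespan`). Hence `T ≥ a₁(0)/8`.

Initial data: for `(1 + ε, 1, ε²)` the plane of the first and third directions has sectional
curvature of order `4/ε`. The scalar curvature stays positive, because `a₂` dominates the squared
gap `(a₀ - a₁)²` (`exists_initialData`). Rescaling to `‖Rm‖ = 1` multiplies the metric by at least
`1/ε`, so `a₁(0) ≥ 1/ε` and `T → ∞`. Part (2) is part (1) read at `t = 0`, where `‖Rm‖ (T - t) = T`.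

The rest ties this to the general definitions. The Levi-Civita connection is unique on
differentiable fields, so the chosen one can be replaced by an explicit one (`leviCivita_eq`).
Curvature, defined through arbitrary extensions, depends only on pointwise components
(`comps_curvatureField`). Traces and norms do not depend on the chosen orthonormal basis. An
extension of the Ricci flow past `T`, of whatever form, would extend the ODE solution
(`hasExtinctionTime_of_isSolutionOn`). -/

noncomputable section

/-! ### The Lie bracket as a commutator of derivations -/

section Bracket

variable {E : Type*} [NormedAddCommGroup E] [NormedSpace ℝ E]
  {H : Type*} [TopologicalSpace H] {I : ModelWithCorners ℝ E H} [I.Boundaryless]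
  {M : Type*} [TopologicalSpace M] [ChartedSpace H M] [IsManifold I 2 M]
  {F : Type*} [NormedAddCommGroup F] [NormedSpace ℝ F]

open VectorField

theorem fderiv_chart_apply {f : M → F} {x : M} {e : E} (he : e ∈ (extChartAt I x).target)
    (hf : MDifferentiableAt I 𝓘(ℝ, F) f ((extChartAt I x).symm e)) (v : E) :
    fderiv ℝ (f ∘ (extChartAt I x).symm) e v =
      mvfderiv I f ((extChartAt I x).symm e) (mfderivWithin 𝓘(ℝ, E) I (extChartAt I x).symm (range I) e v) := by
  have : IsManifold I 1 M := .of_le (n := 2) (by norm_num)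
  have hφ : MDifferentiableAt 𝓘(ℝ, E) I (extChartAt I x).symm e := by
    have := (mdifferentiableWithinAt_extChartAt_symm (I := I) he)
    rwa [I.range_eq_univ, mdifferentiableWithinAt_univ] at this
  have hc := mfderiv_comp (I'' := 𝓘(ℝ, F)) e hf hφ
  rw [mfderiv_eq_fderiv] at hc
  rw [hc, I.range_eq_univ, mfderivWithin_univ]
  rfl

variable (I) in
/-- The expression of the vector field `V` in the chart at `x`. -/
def chartField (V : Π x : M, TangentSpace I x) (x : M) : E → E :=
  mpullbackWithin 𝓘(ℝ, E) I (extChartAt I x).symm V (range I)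

/-- In the chart at `x`, the derivative of `f` along `V` is the derivative of the chart expression
of `f` along the chart expression of `V`. -/
theorem eventually_mvfderiv_apply_eq_fderiv_chart {f : M → F} {x : M}
    (hf : ContMDiffAt I 𝓘(ℝ, F) 2 f x) (V : Π x : M, TangentSpace I x) :
    (fun y ↦ mvfderiv I f y (V y)) =ᶠ[𝓝 x]
      (fun e ↦ fderiv ℝ (f ∘ (extChartAt I x).symm) e
        (chartField I V x e)) ∘ extChartAt I x := by
  have : IsManifold I 1 M := .of_le (n := 2) (by norm_num)
  have h1 : ∀ᶠ y in 𝓝 x, ContMDiffAt I 𝓘(ℝ, F) 2 f y :=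
    (contMDiffAt_iff_contMDiffAt_nhds (by simp)).1 hf
  filter_upwards [h1, extChartAt_source_mem_nhds (I := I) x] with y hy hys
  have hyt : extChartAt I x y ∈ (extChartAt I x).target := (extChartAt I x).map_source hys
  have hinv := isInvertible_mfderivWithin_extChartAt_symm hyt
  have hl := (extChartAt I x).left_inv hys
  have hfy : MDifferentiableAt I 𝓘(ℝ, F) f ((extChartAt I x).symm (extChartAt I x y)) := by
    rw [hl]
    exact hy.mdifferentiableAt (by simp)
  rw [Function.comp_apply]
  refine Eq.trans ?_ (fderiv_chart_apply hyt hfy _).symm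
  have h2 := ContinuousLinearMap.IsInvertible.self_apply_inverse hinv
    (V ((extChartAt I x).symm (extChartAt I x y)))
  refine Eq.trans ?_ (congrArg (mvfderiv I f ((extChartAt I x).symm (extChartAt I x y))) h2.symm)
  rw [hl]

theorem differentiableAt_fderiv_chart_apply [CompleteSpace E] {f : M → F} {x : M}
    (hf : ContMDiffAt I 𝓘(ℝ, F) 2 f x) {V : Π x : M, TangentSpace I x}
    (hV : MDifferentiableAt I I.tangent (fun x ↦ (V x : TangentBundle I M)) x) :
    ContDiffAt ℝ 2 (f ∘ (extChartAt I x).symm) (extChartAt I x x) ∧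
    DifferentiableAt ℝ (chartField I V x)
      (extChartAt I x x) ∧
    DifferentiableAt ℝ (fun e ↦ fderiv ℝ (f ∘ (extChartAt I x).symm) e
        (chartField I V x e)) (extChartAt I x x) := by
  have h1 : ContDiffAt ℝ 2 (f ∘ (extChartAt I x).symm) (extChartAt I x x) := by
    have := (contMDiffAt_iff.1 hf).2
    rw [I.range_eq_univ, contDiffWithinAt_univ] at this
    exact this
  have h2 : DifferentiableAt ℝ (chartField I V x)
      (extChartAt I x x) := by
    have h : DifferentiableWithinAt ℝ (chartField I V x)
        ((extChartAt I x).symm ⁻¹' univ ∩ range I) (extChartAt I x x) :=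
      MDifferentiableWithinAt.differentiableWithinAt_mpullbackWithin_vectorField
        (s := univ) hV.mdifferentiableWithinAt
    rwa [preimage_univ, univ_inter, I.range_eq_univ, differentiableWithinAt_univ] at h
  refine ⟨h1, h2, ?_⟩
  exact ((h1.fderiv_right (m := 1) (by norm_num)).differentiableAt (by simp)).clm_apply h2

theorem mdifferentiableAt_mvfderiv_apply [CompleteSpace E] {f : M → F} {x : M}
    (hf : ContMDiffAt I 𝓘(ℝ, F) 2 f x) {V : Π x : M, TangentSpace I x}
    (hV : MDifferentiableAt I I.tangent (fun x ↦ (V x : TangentBundle I M)) x) :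
    MDifferentiableAt I 𝓘(ℝ, F) (fun y ↦ mvfderiv I f y (V y)) x := by
  have : IsManifold I 1 M := .of_le (n := 2) (by norm_num)
  refine MDifferentiableAt.congr_of_eventuallyEq ?_
    (eventually_mvfderiv_apply_eq_fderiv_chart hf V)
  exact ((differentiableAt_fderiv_chart_apply hf hV).2.2.mdifferentiableAt).comp x
    (mdifferentiableAt_extChartAt (ChartedSpace.mem_chart_source x))

theorem mvfderiv_mvfderiv_apply [CompleteSpace E] {f : M → F} {x : M}
    (hf : ContMDiffAt I 𝓘(ℝ, F) 2 f x) {V : Π x : M, TangentSpace I x}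
    (hV : MDifferentiableAt I I.tangent (fun x ↦ (V x : TangentBundle I M)) x)
    (W : Π x : M, TangentSpace I x) :
    mvfderiv I (fun y ↦ mvfderiv I f y (V y)) x (W x) =
      fderiv ℝ (fun e ↦ fderiv ℝ (f ∘ (extChartAt I x).symm) e
        (chartField I V x e)) (extChartAt I x x)
        (chartField I W x (extChartAt I x x)) := by
  have : IsManifold I 1 M := .of_le (n := 2) (by norm_num)
  have hd := (differentiableAt_fderiv_chart_apply hf hV).2.2
  have hinv := isInvertible_mfderivWithin_extChartAt_symm (I := I)
    (mem_extChartAt_target (I := I) x)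
  have hf' := mdifferentiableAt_mvfderiv_apply hf hV
  have hl := extChartAt_to_inv (I := I) x
  have key := fderiv_chart_apply (I := I) (x := x) (mem_extChartAt_target (I := I) x)
    (f := fun y ↦ mvfderiv I f y (V y)) (by rwa [hl])
    (chartField I W x (extChartAt I x x))
  have h2 := ContinuousLinearMap.IsInvertible.self_apply_inverse hinv
    (W ((extChartAt I x).symm (extChartAt I x x)))
  have h3 := key.trans (congrArg (mvfderiv I (fun y ↦ mvfderiv I f y (V y)) _) h2)
  rw [hl] at h3
  rw [← h3]
  refine congrArg (fun L : E →L[ℝ] F ↦ L (chartField I W x (extChartAt I x x))) ?_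
  apply Filter.EventuallyEq.fderiv_eq
  have hev := eventually_mvfderiv_apply_eq_fderiv_chart hf V
  have hc : Tendsto (extChartAt I x).symm (𝓝 (extChartAt I x x)) (𝓝 x) := by
    have := (continuousAt_extChartAt_symm (I := I) x).tendsto
    rwa [hl] at this
  filter_upwards [hc.eventually hev, extChartAt_target_mem_nhds (I := I) x] with e he het
  simp only [Function.comp_apply] at he ⊢
  rw [he, (extChartAt I x).right_inv het]

/-- The differentiation operator along `[V, W]`
is the commutator of the differentiation operators along `V` and `W`. -/
theorem mvfderiv_mlieBracket [CompleteSpace E] {f : M → F} {x : M}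
    (hf : ContMDiffAt I 𝓘(ℝ, F) 2 f x) {V W : Π x : M, TangentSpace I x}
    (hV : MDifferentiableAt I I.tangent (fun x ↦ (V x : TangentBundle I M)) x)
    (hW : MDifferentiableAt I I.tangent (fun x ↦ (W x : TangentBundle I M)) x) :
    mvfderiv I f x (mlieBracket I V W x) =
      mvfderiv I (fun y ↦ mvfderiv I f y (W y)) x (V x) -
        mvfderiv I (fun y ↦ mvfderiv I f y (V y)) x (W x) := by
  have : IsManifold I 1 M := .of_le (n := 2) (by norm_num)
  -- In the chart the claim is the Euclidean one, where the symmetric second derivative of `f`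
  -- cancels. It remains to carry the chart bracket back to the manifold.
  rw [mvfderiv_mvfderiv_apply hf hW, mvfderiv_mvfderiv_apply hf hV,
    ← fderiv_apply_lieBracket (n := 2) (differentiableAt_fderiv_chart_apply hf hV).1 (by simp)
      (differentiableAt_fderiv_chart_apply hf hW).2.1
      (differentiableAt_fderiv_chart_apply hf hV).2.1]
  have hl := extChartAt_to_inv (I := I) x
  have hfx := hf.mdifferentiableAt (by simp)
  rw [fderiv_chart_apply (I := I) (mem_extChartAt_target (I := I) x) (by rwa [hl])]
  have h4 : mlieBracket I V W x = (mfderiv I 𝓘(ℝ, E) (extChartAt I x) x).inverse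
      (lieBracketWithin (E := E) ℝ (chartField I V x) (chartField I W x)
        ((extChartAt I x).symm ⁻¹' univ ∩ range I) (extChartAt I x x)) :=
    mlieBracketWithin_apply (I := I) (V := V) (W := W) (s := univ) (x₀ := x)
  have h5 : (extChartAt I x).symm ⁻¹' univ ∩ range I = univ := by
    rw [preimage_univ, univ_inter, I.range_eq_univ]
  rw [h5, lieBracketWithin_univ] at h4
  have h6 : (mfderiv I 𝓘(ℝ, E) (extChartAt I x) x).inverse =
      mfderivWithin 𝓘(ℝ, E) I (extChartAt I x).symm (range I) (extChartAt I x x) := by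
    apply ContinuousLinearMap.inverse_eq
    · exact mfderiv_extChartAt_comp_mfderivWithin_extChartAt_symm' (mem_extChartAt_source x)
    · exact mfderivWithin_extChartAt_symm_comp_mfderiv_extChartAt' (mem_extChartAt_source x)
  rw [h4, h6, hl]

end Bracket

section Sum

variable {E : Type*} [NormedAddCommGroup E] [NormedSpace ℝ E]
  {H : Type*} [TopologicalSpace H] {I : ModelWithCorners ℝ E H}
  {M : Type*} [TopologicalSpace M] [ChartedSpace H M]
  {F : Type*} [NormedAddCommGroup F] [NormedSpace ℝ F]

theorem mdifferentiableAt_and_mvfderiv_sum {ι : Type*} {s : Finset ι} {f : ι → M → F} {x : M}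
    (hf : ∀ i ∈ s, MDifferentiableAt I 𝓘(ℝ, F) (f i) x) :
    MDifferentiableAt I 𝓘(ℝ, F) (fun y ↦ ∑ i ∈ s, f i y) x ∧
      mvfderiv I (fun y ↦ ∑ i ∈ s, f i y) x = ∑ i ∈ s, mvfderiv I (f i) x := by
  classical
  induction s using Finset.induction_on with
  | empty => exact ⟨by simpa using mdifferentiableAt_const, by simpa using mvfderiv_const 0⟩
  | insert a s ha ih =>
    simp only [Finset.mem_insert, forall_eq_or_imp] at hf
    obtain ⟨h1, h2⟩ := ih hf.2
    simp only [Finset.sum_insert ha]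
    exact ⟨hf.1.add h1, by rw [mvfderiv_fun_add hf.1 h1, h2]⟩

end Sum

/-! ### Uniqueness of the Levi-Civita connection -/

section LeviCivita

variable {E : Type*} [NormedAddCommGroup E] [NormedSpace ℝ E] [FiniteDimensional ℝ E]
  {H : Type*} [TopologicalSpace H] {I : ModelWithCorners ℝ E H}
  {M : Type*} [TopologicalSpace M] [ChartedSpace H M] [IsManifold I ∞ M]

/-- Two Levi-Civita connections of a metric agree on differentiable vector fields. -/
theorem IsLeviCivita.unique {g : SmoothMetric I M}
    {cov cov' : CovariantDerivative I E (TangentSpace I : M → Type _)}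
    (h : IsLeviCivita g cov) (h' : IsLeviCivita g cov') {Y : VField I M} {x : M}
    (hY : MDiffAt (T% Y) x) : cov Y x = cov' Y x := by
  have : IsManifold I 1 M := .of_le (n := ∞) (by norm_num)
  have : IsManifold I 2 M := .of_le (n := ∞) (WithTop.coe_le_coe.2 le_top)
  -- The difference of two connections is a tensor, so its properties may be tested on extensions of
  -- tangent vectors.
  let D := IsCovariantDerivativeOn.difference cov.isCovariantDerivativeOnUniv
    cov'.isCovariantDerivativeOnUniv x
  have hD : ∀ {Z : VField I M}, MDiffAt (T% Z) x → D (Z x) = cov Z x - cov' Z x := fun hZ ↦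
    IsCovariantDerivativeOn.difference_apply cov.isCovariantDerivativeOnUniv
      cov'.isCovariantDerivativeOnUniv (mem_univ x) hZ
  have hext : ∀ v : TangentSpace I x, MDiffAt (T% (FiberBundle.extend E v : VField I M)) x :=
    fun v ↦ FiberBundle.mdifferentiableAt_extend I E v
  have hsymm : ∀ v w, D v w = D w v := by
    intro v w
    have h1 := cov.torsion_eq_zero_iff.1 h.torsion_eq_zero (hext v) (hext w)
    have h2 := cov'.torsion_eq_zero_iff.1 h'.torsion_eq_zero (hext v) (hext w)
    have h3 := hD (hext v)
    have h4 := hD (hext w)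
    rw [FiberBundle.extend_apply_self] at h1 h2 h3 h4
    rw [h3, h4]
    simp only [_root_.sub_apply]
    rw [FiberBundle.extend_apply_self] at h1 h2
    rw [← h2] at h1
    rw [sub_eq_sub_iff_add_eq_add] at h1 ⊢
    rw [← sub_eq_zero] at h1 ⊢
    rw [← neg_eq_zero, ← h1]
    abel
  have hanti : ∀ v y z, g.inner x (D y v) z + g.inner x y (D z v) = 0 := by
    intro v y z
    have h1 := h.compatible _ _ x (hext y) (hext z) v
    have h2 := h'.compatible _ _ x (hext y) (hext z) v
    have h3 := hD (hext y)
    have h4 := hD (hext z)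
    rw [FiberBundle.extend_apply_self] at h3 h4
    rw [h2, FiberBundle.extend_apply_self, FiberBundle.extend_apply_self] at h1
    rw [h3, h4]
    simp only [_root_.sub_apply, map_sub]
    linear_combination -h1
  -- A trilinear form symmetric in its first two slots and skew in its last two vanishes: permute
  -- cyclically.
  have hT : ∀ v y z, g.inner x (D y v) z = 0 := by
    intro v y z
    have a1 := hanti v y z
    have a2 := hanti y z v
    have a3 := hanti z v y
    rw [g.symm x y] at a1
    rw [g.symm x z] at a2
    rw [g.symm x v] at a3
    rw [hsymm z v] at a1
    rw [hsymm v y] at a2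
    rw [hsymm y z] at a3
    linarith
  have h0 : D (Y x) = 0 := by
    ext v
    by_contra hne
    exact (g.pos x _ hne).ne' (hT v (Y x) _)
  rwa [hD hY, sub_eq_zero] at h0

/-- `leviCivita` picks an unspecified connection; by uniqueness any explicit Levi-Civita connection
computes it on fields differentiable at the point. -/
theorem leviCivita_eq {g : SmoothMetric I M}
    {cov : CovariantDerivative I E (TangentSpace I : M → Type _)}
    (h : IsLeviCivita g cov) {Y : VField I M} {x : M} (hY : MDiffAt (T% Y) x) :
    leviCivita g Y x = cov Y x := by
  have hex : ∃ cov, IsLeviCivita g cov := ⟨cov, h⟩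
  rw [leviCivita, dif_pos hex]
  exact hex.choose_spec.unique h hY

end LeviCivita

/-! ### Independence of the orthonormal basis -/

section Orthonormal

variable {V ι κ : Type*} [AddCommGroup V] [Module ℝ V] [Fintype ι] [Fintype κ] [DecidableEq ι]
  [DecidableEq κ] {G : V →ₗ[ℝ] V →ₗ[ℝ] ℝ}

/-- The trace of a bilinear form does not depend on the orthonormal basis. -/
theorem sum_bilin_orthonormal (hG : ∀ v w, G v w = G w v) {e : Basis ι ℝ V} {f : Basis κ ℝ V}
    (he : ∀ i j, G (e i) (e j) = if i = j then 1 else 0)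
    (hf : ∀ i j, G (f i) (f j) = if i = j then 1 else 0) (B : V →ₗ[ℝ] V →ₗ[ℝ] ℝ) :
    ∑ i, B (e i) (e i) = ∑ k, B (f k) (f k) := by
  have hexp : ∀ v, v = ∑ k, G v (f k) • f k := by
    intro v
    conv_lhs => rw [← f.sum_repr v]
    refine Finset.sum_congr rfl fun k _ ↦ congrArg (· • f k) ?_
    have : G (∑ j, f.repr v j • f j) (f k) = f.repr v k := by simp [-Basis.sum_repr, hf]
    rwa [f.sum_repr, eq_comm] at this
  have hexp' : ∀ v, v = ∑ k, G v (e k) • e k := by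
    intro v
    conv_lhs => rw [← e.sum_repr v]
    refine Finset.sum_congr rfl fun k _ ↦ congrArg (· • e k) ?_
    have : G (∑ j, e.repr v j • e j) (e k) = e.repr v k := by simp [-Basis.sum_repr, he]
    rwa [e.sum_repr, eq_comm] at this
  -- The transition matrix between the two bases is orthogonal.
  have hO : ∀ k l, ∑ i, G (e i) (f k) * G (e i) (f l) = if k = l then 1 else 0 := by
    intro k l
    rw [← hf k l]
    conv_rhs => rw [hexp' (f k)]
    simp [hG (f k)]
  calc ∑ i, B (e i) (e i)
      = ∑ i, ∑ k, ∑ l, (G (e i) (f k) * G (e i) (f l)) * B (f k) (f l) := by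
        refine Finset.sum_congr rfl fun i _ ↦ ?_
        conv_lhs => rw [hexp (e i)]
        simp only [map_sum, LinearMap.sum_apply, map_smul, LinearMap.smul_apply, smul_eq_mul,
          Finset.mul_sum]
        rw [Finset.sum_comm]
        refine Finset.sum_congr rfl fun k _ ↦ Finset.sum_congr rfl fun l _ ↦ ?_
        ring
    _ = ∑ k, ∑ l, (∑ i, G (e i) (f k) * G (e i) (f l)) * B (f k) (f l) := by
        rw [Finset.sum_comm]
        refine Finset.sum_congr rfl fun k _ ↦ ?_
        rw [Finset.sum_comm]
        refine Finset.sum_congr rfl fun l _ ↦ ?_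
        rw [Finset.sum_mul]
    _ = ∑ k, B (f k) (f k) := by simp [hO]

theorem sum_sq_orthonormal (hG : ∀ v w, G v w = G w v) {e : Basis ι ℝ V} {f : Basis κ ℝ V}
    (he : ∀ i j, G (e i) (e j) = if i = j then 1 else 0)
    (hf : ∀ i j, G (f i) (f j) = if i = j then 1 else 0) {L : V → ℝ} (hL : IsLinearMap ℝ L) :
    ∑ i, L (e i) ^ 2 = ∑ k, L (f k) ^ 2 := by
  have := sum_bilin_orthonormal hG he hf
    ((LinearMap.mul ℝ ℝ).compl₁₂ (hL.mk' L) (hL.mk' L))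
  simpa [sq] using this

/-- The norm of a covariant 4-tensor does not depend on the orthonormal basis. -/
theorem sum_sq_tensor_orthonormal (hG : ∀ v w, G v w = G w v) {e : Basis ι ℝ V} {f : Basis κ ℝ V}
    (he : ∀ i j, G (e i) (e j) = if i = j then 1 else 0)
    (hf : ∀ i j, G (f i) (f j) = if i = j then 1 else 0) {R : V → V → V → V → ℝ}
    (h₁ : ∀ b c d, IsLinearMap ℝ fun a ↦ R a b c d) (h₂ : ∀ a c d, IsLinearMap ℝ fun b ↦ R a b c d)
    (h₃ : ∀ a b d, IsLinearMap ℝ fun c ↦ R a b c d)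
    (h₄ : ∀ a b c, IsLinearMap ℝ fun d ↦ R a b c d) :
    ∑ i, ∑ j, ∑ k, ∑ l, R (e i) (e j) (e k) (e l) ^ 2 =
      ∑ i, ∑ j, ∑ k, ∑ l, R (f i) (f j) (f k) (f l) ^ 2 := by
  -- The basis is exchanged in one slot at a time; each reordering brings the next index to the
  -- innermost sum, where `sum_sq_orthonormal` applies.
  calc _ = ∑ i, ∑ j, ∑ k, ∑ l, R (e i) (e j) (e k) (f l) ^ 2 := by
        refine Finset.sum_congr rfl fun i _ ↦ Finset.sum_congr rfl fun j _ ↦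
          Finset.sum_congr rfl fun k _ ↦ sum_sq_orthonormal hG he hf (h₄ _ _ _)
    _ = ∑ i, ∑ j, ∑ l, ∑ k, R (e i) (e j) (f k) (f l) ^ 2 := by
        refine Finset.sum_congr rfl fun i _ ↦ Finset.sum_congr rfl fun j _ ↦ ?_
        rw [Finset.sum_comm]
        exact Finset.sum_congr rfl fun l _ ↦ sum_sq_orthonormal hG he hf (h₃ _ _ _)
    _ = ∑ i, ∑ l, ∑ k, ∑ j, R (e i) (f j) (f k) (f l) ^ 2 := by
        refine Finset.sum_congr rfl fun i _ ↦ ?_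
        rw [Finset.sum_comm]
        refine Finset.sum_congr rfl fun l _ ↦ ?_
        rw [Finset.sum_comm]
        exact Finset.sum_congr rfl fun k _ ↦ sum_sq_orthonormal hG he hf (h₂ _ _ _)
    _ = ∑ l, ∑ k, ∑ j, ∑ i, R (f i) (f j) (f k) (f l) ^ 2 := by
        rw [Finset.sum_comm]
        refine Finset.sum_congr rfl fun l _ ↦ ?_
        rw [Finset.sum_comm]
        refine Finset.sum_congr rfl fun k _ ↦ ?_
        rw [Finset.sum_comm]
        exact Finset.sum_congr rfl fun j _ ↦ sum_sq_orthonormal hG he hf (h₁ _ _ _)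
    _ = ∑ i, ∑ j, ∑ k, ∑ l, R (f i) (f j) (f k) (f l) ^ 2 := by
        have h3 : ∀ F : κ → κ → κ → ℝ, ∑ l, ∑ k, ∑ j, F j k l = ∑ j, ∑ k, ∑ l, F j k l := by
          intro F
          rw [Finset.sum_congr rfl fun l _ ↦ Finset.sum_comm (f := fun k j ↦ F j k l),
            Finset.sum_comm]
          exact Finset.sum_congr rfl fun j _ ↦ Finset.sum_comm
        rw [Finset.sum_congr rfl fun l _ ↦ h3 fun i j k ↦ R (f i) (f j) (f k) (f l) ^ 2,
          Finset.sum_comm]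
        refine Finset.sum_congr rfl fun i _ ↦ ?_
        rw [Finset.sum_comm]
        exact Finset.sum_congr rfl fun j _ ↦ Finset.sum_comm

end Orthonormal

/-! ### The left-invariant frame and coframe of `S³` -/

section Frame

theorem contMDiff_mul_S3 {n : ℕ∞ω} : ContMDiff ((𝓡 3).prod (𝓡 3)) (𝓡 3) n
    (fun p : S3 × S3 ↦ p.1 * p.2) := by
  apply ContMDiff.codRestrict_sphere
  have h₂ : ContMDiff (𝓘(ℝ, ℍ[ℝ]).prod 𝓘(ℝ, ℍ[ℝ])) 𝓘(ℝ, ℍ[ℝ]) n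
      fun z : ℍ[ℝ] × ℍ[ℝ] => z.fst * z.snd := by
    rw [contMDiff_iff]
    exact ⟨continuous_mul, fun x y => contDiff_mul.contDiffOn⟩
  exact h₂.comp (contMDiff_coe_sphere.prodMap contMDiff_coe_sphere)

theorem lieGroup_S3 {n : ℕ∞ω} : LieGroup (𝓡 3) n S3 where
  contMDiff_mul := contMDiff_mul_S3
  contMDiff_inv := by
    apply ContMDiff.codRestrict_sphere
    have : ∀ x : S3, ((x⁻¹ : S3) : ℍ[ℝ]) = star (x : ℍ[ℝ]) := by
      intro x
      have hx : ‖(x : ℍ[ℝ])‖ = 1 := norm_eq_of_mem_sphere x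
      have h1 : Quaternion.normSq (x : ℍ[ℝ]) = 1 := by
        rw [Quaternion.normSq_eq_norm_mul_self, hx, one_mul]
      change (x : ℍ[ℝ])⁻¹ = _
      rw [Quaternion.inv_def, h1, inv_one, one_smul]
    refine ContMDiff.congr (f := fun x : S3 ↦ star (x : ℍ[ℝ])) ?_ this
    let L : ℍ[ℝ] →ₗ[ℝ] ℍ[ℝ] :=
      { toFun := star
        map_add' := star_add
        map_smul' := fun r q ↦ by ext <;> simp }
    exact L.toContinuousLinearMap.contDiff.contMDiff.comp contMDiff_coe_sphere

attribute [local instance] lieGroup_S3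

/-- The imaginary units `i, j, k`. -/
def imUnit : Fin 3 → ℍ[ℝ] := ![⟨0, 1, 0, 0⟩, ⟨0, 0, 1, 0⟩, ⟨0, 0, 0, 1⟩]

theorem imUnit_re (i : Fin 3) : (imUnit i).re = 0 := by
  fin_cases i <;> rfl

theorem imUnit_imI (i : Fin 3) : (imUnit i).imI = if i = 0 then 1 else 0 := by
  fin_cases i <;> rfl

theorem imUnit_imJ (i : Fin 3) : (imUnit i).imJ = if i = 1 then 1 else 0 := by
  fin_cases i <;> rfl

theorem imUnit_imK (i : Fin 3) : (imUnit i).imK = if i = 2 then 1 else 0 := by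
  fin_cases i <;> rfl

/-- The differential of the inclusion `S³ → ℍ`. -/
abbrev dIncl (x : S3) : TangentSpace (𝓡 3) x →L[ℝ] ℍ[ℝ] :=
  mvfderiv (𝓡 3) ((↑) : S3 → ℍ[ℝ]) x

theorem inner_mul_left_S3 (x : S3) (p q : ℍ[ℝ]) :
    inner ℝ ((x : ℍ[ℝ]) * p) ((x : ℍ[ℝ]) * q) = inner ℝ p q := by
  have hx : ‖(x : ℍ[ℝ])‖ = 1 := norm_eq_of_mem_sphere x
  have h1 : Quaternion.normSq (x : ℍ[ℝ]) = 1 := by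
    rw [Quaternion.normSq_eq_norm_mul_self, hx, one_mul]
  rw [Quaternion.normSq_def'] at h1
  simp only [Quaternion.inner_def, Quaternion.re_mul, Quaternion.imI_mul, Quaternion.imJ_mul,
    Quaternion.imK_mul, Quaternion.re_star, Quaternion.imI_star, Quaternion.imJ_star,
    Quaternion.imK_star]
  linear_combination (p.re * q.re + p.imI * q.imI + p.imJ * q.imJ + p.imK * q.imK) * h1

theorem dIncl_mul_left (a x : S3) (v : TangentSpace (𝓡 3) x) :
    dIncl (a * x) (mfderiv (𝓡 3) (𝓡 3) (fun y : S3 ↦ a * y) x v) = (a : ℍ[ℝ]) * dIncl x v := by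
  have h1 : MDifferentiableAt (𝓡 3) (𝓡 3) (fun y : S3 ↦ a * y) x :=
    (contMDiff_mul_left (I := 𝓡 3) (n := ∞)).mdifferentiableAt (by simp)
  have h2 : ∀ y : S3, MDifferentiableAt (𝓡 3) 𝓘(ℝ, ℍ[ℝ]) ((↑) : S3 → ℍ[ℝ]) y := fun y ↦
    (contMDiff_coe_sphere (m := 1)).mdifferentiableAt (by simp)
  have h3 := mfderiv_comp_apply x (h2 (a * x)) h1 v
  have h4 : MDifferentiableAt 𝓘(ℝ, ℍ[ℝ]) 𝓘(ℝ, ℍ[ℝ]) (fun q ↦ (a : ℍ[ℝ]) * q) (x : ℍ[ℝ]) :=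
    ((ContinuousLinearMap.mul ℝ ℍ[ℝ] (a : ℍ[ℝ])).differentiableAt).mdifferentiableAt
  have h5 := mfderiv_comp_apply x h4 (h2 x) v
  have h6 : mfderiv 𝓘(ℝ, ℍ[ℝ]) 𝓘(ℝ, ℍ[ℝ]) (fun q ↦ (a : ℍ[ℝ]) * q) (x : ℍ[ℝ]) =
      ContinuousLinearMap.mul ℝ ℍ[ℝ] (a : ℍ[ℝ]) := by
    rw [mfderiv_eq_fderiv]
    exact (ContinuousLinearMap.mul ℝ ℍ[ℝ] (a : ℍ[ℝ])).fderiv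
  rw [h6] at h5
  exact h3.symm.trans h5

/-- The components of the left-invariant coframe dual to `i, j, k`. -/
def coframe (x : S3) (i : Fin 3) : TangentSpace (𝓡 3) x →L[ℝ] ℝ :=
  innerSL ℝ ((x : ℍ[ℝ]) * imUnit i) ∘L dIncl x

theorem coframe_apply (x : S3) (i : Fin 3) (v : TangentSpace (𝓡 3) x) :
    coframe x i v = inner ℝ ((x : ℍ[ℝ]) * imUnit i) (dIncl x v) := rfl

theorem coframe_mul_left (a x : S3) (i : Fin 3) (v : TangentSpace (𝓡 3) x) :
    coframe (a * x) i (mfderiv (𝓡 3) (𝓡 3) (fun y : S3 ↦ a * y) x v) = coframe x i v := by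
  rw [coframe_apply, coframe_apply, dIncl_mul_left, ← inner_mul_left_S3 a (x * imUnit i),
    ← mul_assoc]
  rfl

theorem inner_dIncl (x : S3) (v : TangentSpace (𝓡 3) x) : inner ℝ (x : ℍ[ℝ]) (dIncl x v) = 0 := by
  have h : dIncl x v ∈ (mvfderiv (𝓡 3) ((↑) : S3 → ℍ[ℝ]) x).range := ⟨v, rfl⟩
  rw [range_mvfderiv_subtypeVal] at h
  exact Submodule.mem_orthogonal_singleton_iff_inner_right.1 h

/-- Translating back to the identity, `x̄ · dι(v)` is purely imaginary because `dι(v)` is orthogonal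
to `x`, so it expands in `i, j, k`. -/
theorem dIncl_eq_sum (x : S3) (v : TangentSpace (𝓡 3) x) :
    dIncl x v = ∑ i, coframe x i v • ((x : ℍ[ℝ]) * imUnit i) := by
  have hx : (x : ℍ[ℝ]) * star (x : ℍ[ℝ]) = 1 := by
    have h1 : ‖(x : ℍ[ℝ])‖ = 1 := norm_eq_of_mem_sphere x
    rw [Quaternion.self_mul_star, Quaternion.normSq_eq_norm_mul_self, h1]
    simp
  have hq : dIncl x v = x * (star (x : ℍ[ℝ]) * dIncl x v) := by rw [← mul_assoc, hx, one_mul]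
  have h0 := inner_dIncl x v
  simp only [coframe_apply]
  rw [hq] at h0 ⊢
  generalize star (x : ℍ[ℝ]) * dIncl x v = q at h0 ⊢
  have h0' : q.re = 0 := by
    nth_rw 1 [← mul_one (x : ℍ[ℝ])] at h0
    rw [inner_mul_left_S3] at h0
    simpa [Quaternion.inner_def] using h0
  simp only [inner_mul_left_S3, ← mul_smul_comm, ← Finset.mul_sum]
  congr 1
  ext <;> simp [Fin.sum_univ_three, imUnit_re, imUnit_imI, imUnit_imJ, imUnit_imK,
    Quaternion.inner_def, h0']

theorem exists_dIncl_one (i : Fin 3) : ∃ v : TangentSpace (𝓡 3) (1 : S3), dIncl 1 v = imUnit i := by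
  have h : imUnit i ∈ (mvfderiv (𝓡 3) ((↑) : S3 → ℍ[ℝ]) 1).range := by
    rw [range_mvfderiv_subtypeVal, Submodule.mem_orthogonal_singleton_iff_inner_right]
    simp [imUnit_re, Quaternion.inner_def]
  exact h

/-- The left-invariant vector fields with values `i, j, k` at `1`. -/
def frame (i : Fin 3) : VField (𝓡 3) S3 :=
  mulInvariantVectorField (I := 𝓡 3) (G := S3) (exists_dIncl_one i).choose

theorem mdifferentiableAt_frame (i : Fin 3) (x : S3) :
    MDifferentiableAt (𝓡 3) (𝓡 3).tangent (fun x ↦ (frame i x : TangentBundle (𝓡 3) S3)) x :=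
  mdifferentiableAt_mulInvariantVectorField _

theorem dIncl_frame (i : Fin 3) (x : S3) : dIncl x (frame i x) = (x : ℍ[ℝ]) * imUnit i := by
  have h := dIncl_mul_left x 1 (exists_dIncl_one i).choose
  rw [(exists_dIncl_one i).choose_spec, mul_one] at h
  exact h

theorem inner_imUnit (i j : Fin 3) : inner ℝ (imUnit i) (imUnit j) = if i = j then (1 : ℝ) else 0 := by
  rw [Quaternion.inner_def]
  fin_cases i <;> fin_cases j <;> simp [imUnit_re, imUnit_imI, imUnit_imJ, imUnit_imK]

theorem coframe_frame (x : S3) (i j : Fin 3) : coframe x i (frame j x) = if i = j then 1 else 0 := by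
  rw [coframe_apply, dIncl_frame, inner_mul_left_S3, inner_imUnit]

theorem eq_of_coframe {x : S3} {v w : TangentSpace (𝓡 3) x} (h : ∀ i, coframe x i v = coframe x i w) :
    v = w := by
  apply injective_mvfderiv_subtypeVal_sphere x
  change dIncl x v = dIncl x w
  simp only [dIncl_eq_sum, h]

theorem sum_coframe_frame (x : S3) (v : TangentSpace (𝓡 3) x) :
    ∑ i, coframe x i v • frame i x = v := by
  refine eq_of_coframe fun j ↦ ?_
  simp [coframe_frame]

/-- Structure constants: `[i, j] = 2 k` and so on. -/
def eps (i j k : Fin 3) : ℝ := ((j : ℝ) - i) * ((k : ℝ) - i) * ((k : ℝ) - j) / 2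

theorem contMDiffAt_coframe_apply {n : ℕ∞ω} {x : S3} {V : VField (𝓡 3) S3}
    (hV : ContMDiffAt (𝓡 3) (𝓡 3).tangent n (fun x ↦ (V x : TangentBundle (𝓡 3) S3)) x) (i : Fin 3) :
    ContMDiffAt (𝓡 3) 𝓘(ℝ, ℝ) n (fun y ↦ coframe y i (V y)) x := by
  have h1 : ContMDiff (𝓡 3).tangent 𝓘(ℝ, ℍ[ℝ]).tangent n
      (tangentMap (𝓡 3) 𝓘(ℝ, ℍ[ℝ]) ((↑) : S3 → ℍ[ℝ])) :=
    (contMDiff_coe_sphere (m := ω)).contMDiff_tangentMap le_top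
  have h2 := ((contMDiff_snd_tangentBundle_modelSpace ℍ[ℝ] 𝓘(ℝ, ℍ[ℝ]) (n := n)).comp h1)
  have h3 : ContMDiffAt (𝓡 3) 𝓘(ℝ, ℍ[ℝ]) n (fun y ↦ dIncl y (V y)) x :=
    h2.contMDiffAt.comp x hV
  have h4 : ContMDiffAt (𝓡 3) 𝓘(ℝ, ℍ[ℝ]) n (fun y : S3 ↦ (y : ℍ[ℝ]) * imUnit i) x := by
    have : ContMDiff 𝓘(ℝ, ℍ[ℝ]) 𝓘(ℝ, ℍ[ℝ]) n (fun q : ℍ[ℝ] ↦ q * imUnit i) :=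
      (contDiff_id.mul contDiff_const).contMDiff
    exact (this.comp contMDiff_coe_sphere).contMDiffAt
  have h5 := h4.prodMk_space h3
  exact (contDiff_inner (𝕜 := ℝ) (E := ℍ[ℝ])).contMDiff.contMDiffAt.comp x h5

theorem mdifferentiableAt_mul_right_S3 (q : ℍ[ℝ]) (x : S3) :
    MDifferentiableAt (𝓡 3) 𝓘(ℝ, ℍ[ℝ]) (fun y : S3 ↦ (y : ℍ[ℝ]) * q) x := by
  have : ContMDiff 𝓘(ℝ, ℍ[ℝ]) 𝓘(ℝ, ℍ[ℝ]) 1 (fun p : ℍ[ℝ] ↦ p * q) :=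
    (contDiff_id.mul contDiff_const).contMDiff
  exact (this.comp contMDiff_coe_sphere).mdifferentiableAt (by simp)

theorem mdifferentiableAt_coframe_apply {x : S3} {V : VField (𝓡 3) S3}
    (hV : MDifferentiableAt (𝓡 3) (𝓡 3).tangent (fun x ↦ (V x : TangentBundle (𝓡 3) S3)) x)
    (i : Fin 3) : MDifferentiableAt (𝓡 3) 𝓘(ℝ, ℝ) (fun y ↦ coframe y i (V y)) x := by
  have h3 := mdifferentiableAt_mvfderiv_apply (f := ((↑) : S3 → ℍ[ℝ]))
    contMDiff_coe_sphere.contMDiffAt hV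
  have h5 := (mdifferentiableAt_mul_right_S3 (imUnit i) x).prodMk_space h3
  exact ((contDiff_inner (𝕜 := ℝ) (E := ℍ[ℝ]) (n := 1)).contMDiff.mdifferentiableAt
    (by simp)).comp x h5

theorem inner_imUnit_mul_commutator (i j k : Fin 3) :
    inner ℝ (imUnit k) (imUnit i * imUnit j - imUnit j * imUnit i) = 2 * eps i j k := by
  fin_cases i <;> fin_cases j <;> fin_cases k <;>
    simp [imUnit_re, imUnit_imI, imUnit_imJ, imUnit_imK, Quaternion.inner_def, eps] <;> norm_num

theorem mvfderiv_mul_right_S3 (q : ℍ[ℝ]) (x : S3) (v : TangentSpace (𝓡 3) x) :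
    mvfderiv (𝓡 3) (fun y : S3 ↦ (y : ℍ[ℝ]) * q) x v = dIncl x v * q := by
  have h2 : MDifferentiableAt (𝓡 3) 𝓘(ℝ, ℍ[ℝ]) ((↑) : S3 → ℍ[ℝ]) x :=
    (contMDiff_coe_sphere (m := 1)).mdifferentiableAt (by simp)
  let L := (ContinuousLinearMap.mul ℝ ℍ[ℝ]).flip q
  have h4 : MDifferentiableAt 𝓘(ℝ, ℍ[ℝ]) 𝓘(ℝ, ℍ[ℝ]) L (x : ℍ[ℝ]) :=
    L.differentiableAt.mdifferentiableAt
  have h5 := mfderiv_comp_apply x h4 h2 v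
  rw [mfderiv_eq_fderiv, L.fderiv] at h5
  exact h5

theorem mvfderiv_dIncl_apply {x : S3} {W : VField (𝓡 3) S3}
    (hW : MDifferentiableAt (𝓡 3) (𝓡 3).tangent (fun x ↦ (W x : TangentBundle (𝓡 3) S3)) x)
    (v : TangentSpace (𝓡 3) x) :
    mvfderiv (𝓡 3) (fun y ↦ dIncl y (W y)) x v =
      ∑ j, (mvfderiv (𝓡 3) (fun y ↦ coframe y j (W y)) x v • ((x : ℍ[ℝ]) * imUnit j) +
        coframe x j (W x) • (dIncl x v * imUnit j)) := by
  have h1 : (fun y ↦ dIncl y (W y)) = fun y : S3 ↦ ∑ j, coframe y j (W y) • ((y : ℍ[ℝ]) * imUnit j) :=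
    funext fun y ↦ dIncl_eq_sum y (W y)
  have h2 := fun j ↦ mdifferentiableAt_coframe_apply hW j
  have h3 := fun j ↦ mdifferentiableAt_mul_right_S3 (imUnit j) x
  have h4 : ∀ j ∈ Finset.univ, MDifferentiableAt (𝓡 3) 𝓘(ℝ, ℍ[ℝ])
      (fun y : S3 ↦ coframe y j (W y) • ((y : ℍ[ℝ]) * imUnit j)) x := fun j _ ↦ (h2 j).smul (h3 j)
  rw [h1, (mdifferentiableAt_and_mvfderiv_sum h4).2, sum_apply]
  refine Finset.sum_congr rfl fun j _ ↦ ?_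
  rw [mvfderiv_fun_smul (h2 j) (h3 j)]
  simp only [add_apply, smul_apply, ContinuousLinearMap.smulRight_apply, mvfderiv_mul_right_S3]
  abel

/-- The Maurer–Cartan equation. The commutator formula is applied to the inclusion `S³ → ℍ`:
differentiating `x·uⱼ` along `x·uᵢ` gives `x·uᵢuⱼ`, so the zeroth-order terms combine into
commutators of imaginary units. -/
theorem coframe_mlieBracket {x : S3} {V W : VField (𝓡 3) S3}
    (hV : MDifferentiableAt (𝓡 3) (𝓡 3).tangent (fun x ↦ (V x : TangentBundle (𝓡 3) S3)) x)
    (hW : MDifferentiableAt (𝓡 3) (𝓡 3).tangent (fun x ↦ (W x : TangentBundle (𝓡 3) S3)) x)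
    (k : Fin 3) :
    coframe x k (VectorField.mlieBracket (𝓡 3) V W x) =
      mvfderiv (𝓡 3) (fun y ↦ coframe y k (W y)) x (V x)
      - mvfderiv (𝓡 3) (fun y ↦ coframe y k (V y)) x (W x)
      + 2 * ∑ i, ∑ j, eps i j k * (coframe x i (V x) * coframe x j (W x)) := by
  have h := mvfderiv_mlieBracket (f := ((↑) : S3 → ℍ[ℝ])) contMDiff_coe_sphere.contMDiffAt hV hW
  rw [mvfderiv_dIncl_apply hV, mvfderiv_dIncl_apply hW, dIncl_eq_sum x (V x),
    dIncl_eq_sum x (W x)] at h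
  rw [coframe_apply]
  refine (congrArg (inner ℝ ((x : ℍ[ℝ]) * imUnit k)) h).trans ?_
  have hk : ∀ i j, inner ℝ (imUnit k) (imUnit i * imUnit j) -
      inner ℝ (imUnit k) (imUnit j * imUnit i) = 2 * eps i j k := by
    intro i j
    rw [← inner_sub_right, inner_imUnit_mul_commutator]
  simp only [inner_sub_right, inner_sum, inner_add_right, inner_smul_right, Finset.sum_mul,
    smul_mul_assoc, mul_assoc, inner_mul_left_S3, inner_imUnit, Finset.sum_add_distrib, mul_ite,
    mul_one, mul_zero, Finset.sum_ite_eq, Finset.mem_univ, if_true]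
  have h2 : ∑ i, ∑ j, coframe x i (W x) * (coframe x j (V x) * inner ℝ (imUnit k) (imUnit j * imUnit i))
      - ∑ i, ∑ j, coframe x i (V x) * (coframe x j (W x) * inner ℝ (imUnit k) (imUnit j * imUnit i))
      = 2 * ∑ i, ∑ j, eps i j k * (coframe x i (V x) * coframe x j (W x)) := by
    rw [Finset.sum_comm, ← Finset.sum_sub_distrib, Finset.mul_sum]
    refine Finset.sum_congr rfl fun i _ ↦ ?_
    rw [← Finset.sum_sub_distrib, Finset.mul_sum]
    refine Finset.sum_congr rfl fun j _ ↦ ?_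
    linear_combination (coframe x i (V x) * coframe x j (W x)) * hk i j
  simp only [Finset.mul_sum] at h2 ⊢
  linear_combination h2

end Frame

theorem contDiff_smulRight_self {E : Type*} [NormedAddCommGroup E] [NormedSpace ℝ E] (c : ℝ) :
    ContDiff ℝ ∞ (fun L : E →L[ℝ] ℝ ↦ c • L.smulRight L) :=
  (contDiff_id.smulRight contDiff_id).const_smul c

/-! ### Diagonal left-invariant metrics -/

section DiagonalMetric

/-- The left-invariant bilinear form `∑ aᵢ θᵢ ⊗ θᵢ`. -/
def diagForm (a : Fin 3 → ℝ) (x : S3) :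
    TangentSpace (𝓡 3) x →L[ℝ] TangentSpace (𝓡 3) x →L[ℝ] ℝ :=
  ∑ i, a i • (coframe x i).smulRight (coframe x i)

theorem diagForm_apply (a : Fin 3 → ℝ) (x : S3) (v w : TangentSpace (𝓡 3) x) :
    diagForm a x v w = ∑ i, a i * (coframe x i v * coframe x i w) := by
  simp [diagForm, sum_apply]

/-- Read in a trivialization of the tangent bundle, the form is a polynomial in the coframe
coefficients, and these are smooth because the coframe is evaluated on smooth local fields. -/
theorem contMDiff_diagForm (a : Fin 3 → ℝ) :
    ContMDiff (𝓡 3) ((𝓡 3).prod 𝓘(ℝ, EuclideanSpace ℝ (Fin 3) →L[ℝ] EuclideanSpace ℝ (Fin 3) →L[ℝ] ℝ)) ∞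
      (fun x : S3 ↦ TotalSpace.mk' (EuclideanSpace ℝ (Fin 3) →L[ℝ] EuclideanSpace ℝ (Fin 3) →L[ℝ] ℝ)
        (E := fun x : S3 ↦ TangentSpace (𝓡 3) x →L[ℝ] TangentSpace (𝓡 3) x →L[ℝ] ℝ) x (diagForm a x)) := by
  intro x₀
  rw [contMDiffAt_hom_bundle]
  refine ⟨contMDiffAt_id, ?_⟩
  let t := trivializationAt (EuclideanSpace ℝ (Fin 3)) (TangentSpace (𝓡 3) : S3 → Type _) x₀
  have hx₀ : x₀ ∈ t.baseSet := FiberBundle.mem_baseSet_trivializationAt' x₀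
  let b : Fin 3 → EuclideanSpace ℝ (Fin 3) := fun k ↦ EuclideanSpace.single k 1
  -- the coframe in the trivialization
  let τ : Fin 3 → S3 → EuclideanSpace ℝ (Fin 3) →L[ℝ] ℝ := fun i x ↦
    ∑ k, coframe x i (t.symm x (b k)) • EuclideanSpace.proj k
  have hτ : ∀ i, ContMDiffAt (𝓡 3) 𝓘(ℝ, EuclideanSpace ℝ (Fin 3) →L[ℝ] ℝ) ∞ (τ i) x₀ := by
    intro i
    refine contMDiffAt_finsetSum fun k _ ↦ ?_
    have h1 := FiberBundle.contMDiffAt_extend (𝓡 3) (EuclideanSpace ℝ (Fin 3)) (k := ∞)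
      (t.symm x₀ (b k) : TangentSpace (𝓡 3) x₀)
    simp only [FiberBundle.extend] at h1
    rw [t.apply_mk_symm hx₀] at h1
    have h2 := contMDiffAt_coframe_apply (V := fun x ↦ t.symm x (b k)) h1 i
    exact h2.smul (contMDiffAt_const (c := EuclideanSpace.proj (𝕜 := ℝ) k))
  have hG : ContMDiffAt (𝓡 3)
      𝓘(ℝ, EuclideanSpace ℝ (Fin 3) →L[ℝ] EuclideanSpace ℝ (Fin 3) →L[ℝ] ℝ) ∞
      (fun x ↦ ∑ i, a i • (τ i x).smulRight (τ i x)) x₀ := by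
    refine contMDiffAt_finsetSum fun i _ ↦ ?_
    exact (contDiff_smulRight_self (a i)).contMDiff.contMDiffAt.comp x₀ (hτ i)
  refine hG.congr_of_eventuallyEq ?_
  filter_upwards [t.open_baseSet.mem_nhds hx₀] with x hx
  have hτx : ∀ i v, coframe x i (t.symm x v) = τ i x v := by
    intro i v
    have hv : v = ∑ k, v k • b k := by
      ext j
      simp [b, Pi.single_apply]
    have h1 : coframe x i (t.symmL ℝ x v) = ∑ k, v k • coframe x i (t.symmL ℝ x (b k)) := by
      conv_lhs => rw [hv]
      simp only [map_sum, map_smul]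
    simp only [t.symmL_apply (R := ℝ) hx] at h1
    rw [h1]
    simp [τ, sum_apply, mul_comm]
  ext v w
  rw [inCoordinates_apply_eq₂ hx hx (by simp)]
  change _ = (∑ i, a i • (τ i x).smulRight (τ i x)) v w
  have h1 := diagForm_apply a x (t.symm x v) (t.symm x w)
  simp only [hτx] at h1
  refine Eq.trans (b := diagForm a x (t.symm x v) (t.symm x w)) ?_ (h1.trans ?_)
  · have h2 := Bundle.Trivial.linearMapAt_trivialization ℝ S3 ℝ x
    change (Bundle.Trivial.trivialization S3 ℝ).linearMapAt ℝ x _ = _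
    rw [h2]
    rfl
  · simp [sum_apply]

/-- The left-invariant metric `∑ aᵢ θᵢ²`. -/
def diagMetric (a : Fin 3 → ℝ) (ha : ∀ i, 0 < a i) : SmoothMetric (𝓡 3) S3 where
  inner := diagForm a
  symm x v w := by simp only [diagForm_apply, mul_comm]
  pos x v hv := by
    rw [diagForm_apply]
    have h0 : ∀ i ∈ Finset.univ, 0 ≤ a i * (coframe x i v * coframe x i v) := fun i _ ↦
      mul_nonneg (ha i).le (mul_self_nonneg _)
    refine lt_of_le_of_ne (Finset.sum_nonneg h0) fun h ↦ hv (eq_of_coframe fun i ↦ ?_)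
    have := (Finset.sum_eq_zero_iff_of_nonneg h0).1 h.symm i (Finset.mem_univ i)
    rw [map_zero]
    simpa [(ha i).ne'] using this
  isVonNBounded x := by
    -- `L` rebuilds a vector from its frame components. In the unit ball `θᵢ(v)² ≤ 1/aᵢ ≤ (1 +
    -- 1/aᵢ)²`, so the ball lies in the image of a bounded box; the added `1` avoids square roots.
    let L : (Fin 3 → ℝ) →L[ℝ] TangentSpace (𝓡 3) x :=
      ∑ i, (ContinuousLinearMap.proj (R := ℝ) (φ := fun _ : Fin 3 ↦ ℝ) i).smulRight (frame i x)
    let K : Set (Fin 3 → ℝ) := Set.pi univ fun i ↦ Icc (-(1 + (a i)⁻¹)) (1 + (a i)⁻¹)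
    have hK : Bornology.IsVonNBounded ℝ K :=
      NormedSpace.isVonNBounded_of_isBounded ℝ (isCompact_univ_pi fun i ↦ isCompact_Icc).isBounded
    refine (hK.image L).subset ?_
    intro v hv
    refine ⟨fun i ↦ coframe x i v, fun i _ ↦ ?_, ?_⟩
    · have hv' : diagForm a x v v < 1 := hv
      rw [diagForm_apply] at hv'
      have h0 : ∀ i ∈ Finset.univ, 0 ≤ a i * (coframe x i v * coframe x i v) := fun i _ ↦
        mul_nonneg (ha i).le (mul_self_nonneg _)
      have h1 := (Finset.single_le_sum h0 (Finset.mem_univ i)).trans hv'.le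
      have h2 : coframe x i v ^ 2 ≤ (a i)⁻¹ := by
        rw [← one_div, le_div_iff₀ (ha i)]
        nlinarith
      have h3 : 0 < (a i)⁻¹ := inv_pos.2 (ha i)
      exact abs_le.1 (abs_le_of_sq_le_sq (by nlinarith) (by linarith))
    · simpa [L, sum_apply] using sum_coframe_frame x v
  contMDiff := contMDiff_diagForm a

theorem diagMetric_inner (a : Fin 3 → ℝ) (ha : ∀ i, 0 < a i) (x : S3)
    (v w : TangentSpace (𝓡 3) x) :
    (diagMetric a ha).inner x v w = ∑ i, a i * (coframe x i v * coframe x i w) :=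
  diagForm_apply a x v w

theorem isLeftInvariant_diagMetric (a : Fin 3 → ℝ) (ha : ∀ i, 0 < a i) :
    IsLeftInvariant (diagMetric a ha) := by
  intro b x v w
  simp only [diagMetric_inner, coframe_mul_left]

section

attribute [local instance] lieGroup_S3

/-- Left translation on `S³` as a diffeomorphism. -/
def mulLeftDiffeo (a : S3) : S3 ≃ₘ^∞⟮𝓡 3, 𝓡 3⟯ S3 where
  toEquiv := Equiv.mulLeft a
  contMDiff_toFun := contMDiff_mul_left
  contMDiff_invFun := contMDiff_mul_left

end

theorem IsLeftInvariant.isHomogeneous {g : SmoothMetric (𝓡 3) S3} (hg : IsLeftInvariant g) :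
    IsHomogeneous g := fun p q ↦
  ⟨mulLeftDiffeo (q * p⁻¹), inv_mul_cancel_right q p, fun x v w ↦ hg (q * p⁻¹) x v w⟩

end DiagonalMetric

/-! ### The explicit Levi-Civita connection -/

section Connection

/-- The coefficients of the Levi-Civita connection of `∑ aᵢ θᵢ²` in the left-invariant frame. -/
def christoffel (a : Fin 3 → ℝ) (i j k : Fin 3) : ℝ := eps i j k * (a k + a j - a i) / a k

/-- The covariant derivative `∇_p q` of left-invariant vector fields. -/
def conn (a p q : Fin 3 → ℝ) (k : Fin 3) : ℝ := ∑ i, ∑ j, christoffel a i j k * (p i * q j)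

/-- The bracket of left-invariant vector fields. -/
def brk (p q : Fin 3 → ℝ) (k : Fin 3) : ℝ := 2 * ∑ i, ∑ j, eps i j k * (p i * q j)

theorem conn_add_left (a p p' q : Fin 3 → ℝ) (k : Fin 3) :
    conn a (p + p') q k = conn a p q k + conn a p' q k := by
  simp only [conn, Pi.add_apply, add_mul, mul_add, Finset.sum_add_distrib]

theorem conn_add_right (a p q q' : Fin 3 → ℝ) (k : Fin 3) :
    conn a p (q + q') k = conn a p q k + conn a p q' k := by
  simp only [conn, Pi.add_apply, mul_add, Finset.sum_add_distrib]

theorem conn_smul_left (a p q : Fin 3 → ℝ) (c : ℝ) (k : Fin 3) :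
    conn a (c • p) q k = c * conn a p q k := by
  simp only [conn, Pi.smul_apply, smul_eq_mul, Finset.mul_sum]
  exact Finset.sum_congr rfl fun i _ ↦ Finset.sum_congr rfl fun j _ ↦ by ring

theorem conn_smul_right (a p q : Fin 3 → ℝ) (c : ℝ) (k : Fin 3) :
    conn a p (c • q) k = c * conn a p q k := by
  simp only [conn, Pi.smul_apply, smul_eq_mul, Finset.mul_sum]
  exact Finset.sum_congr rfl fun i _ ↦ Finset.sum_congr rfl fun j _ ↦ by ring

theorem conn_sub_left (a p p' q : Fin 3 → ℝ) (k : Fin 3) :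
    conn a (p - p') q k = conn a p q k - conn a p' q k := by
  simp only [conn, Pi.sub_apply, sub_mul, mul_sub, Finset.sum_sub_distrib]

theorem conn_apply_zero (a p q : Fin 3 → ℝ) :
    conn a p q 0 = ((a 0 + a 2 - a 1) * (p 1 * q 2) - (a 0 + a 1 - a 2) * (p 2 * q 1)) / a 0 := by
  simp [conn, christoffel, eps, Fin.sum_univ_three]
  ring

theorem conn_apply_one (a p q : Fin 3 → ℝ) :
    conn a p q 1 = ((a 1 + a 0 - a 2) * (p 2 * q 0) - (a 1 + a 2 - a 0) * (p 0 * q 2)) / a 1 := by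
  simp [conn, christoffel, eps, Fin.sum_univ_three]
  ring

theorem conn_apply_two (a p q : Fin 3 → ℝ) :
    conn a p q 2 = ((a 2 + a 1 - a 0) * (p 0 * q 1) - (a 2 + a 0 - a 1) * (p 1 * q 0)) / a 2 := by
  simp [conn, christoffel, eps, Fin.sum_univ_three]
  ring

theorem brk_apply_zero (p q : Fin 3 → ℝ) : brk p q 0 = 2 * (p 1 * q 2 - p 2 * q 1) := by
  simp [brk, eps, Fin.sum_univ_three]
  ring

theorem brk_apply_one (p q : Fin 3 → ℝ) : brk p q 1 = 2 * (p 2 * q 0 - p 0 * q 2) := by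
  simp [brk, eps, Fin.sum_univ_three]
  ring

theorem brk_apply_two (p q : Fin 3 → ℝ) : brk p q 2 = 2 * (p 0 * q 1 - p 1 * q 0) := by
  simp [brk, eps, Fin.sum_univ_three]
  ring

theorem conn_sub_swap {a : Fin 3 → ℝ} (ha : ∀ i, 0 < a i) (p q : Fin 3 → ℝ) (k : Fin 3) :
    conn a p q k - conn a q p k = brk p q k := by
  have h0 := (ha 0).ne'
  have h1 := (ha 1).ne'
  have h2 := (ha 2).ne'
  fin_cases k
  · simp only [Fin.zero_eta, conn_apply_zero, brk_apply_zero]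
    field_simp
    ring
  · simp only [Fin.mk_one, conn_apply_one, brk_apply_one]
    field_simp
    ring
  · simp only [Fin.reduceFinMk, conn_apply_two, brk_apply_two]
    field_simp
    ring

/-- Metric compatibility on left-invariant fields: their inner products are constant, so `∇_p` must
be skew. -/
theorem sum_conn_compatible {a : Fin 3 → ℝ} (ha : ∀ i, 0 < a i) (p q r : Fin 3 → ℝ) :
    ∑ k, a k * (conn a p q k * r k) + ∑ k, a k * (q k * conn a p r k) = 0 := by
  have h0 := (ha 0).ne'
  have h1 := (ha 1).ne'
  have h2 := (ha 2).ne'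
  simp only [Fin.sum_univ_three, conn_apply_zero, conn_apply_one, conn_apply_two]
  field_simp
  ring

/-- The components of a tangent vector in the left-invariant frame. -/
def comps (x : S3) (v : TangentSpace (𝓡 3) x) (i : Fin 3) : ℝ := coframe x i v

theorem comps_add (x : S3) (v w : TangentSpace (𝓡 3) x) : comps x (v + w) = comps x v + comps x w :=
  funext fun i ↦ map_add (coframe x i) v w

theorem comps_sub (x : S3) (v w : TangentSpace (𝓡 3) x) : comps x (v - w) = comps x v - comps x w :=
  funext fun i ↦ map_sub (coframe x i) v w

theorem comps_smul (x : S3) (c : ℝ) (v : TangentSpace (𝓡 3) x) : comps x (c • v) = c • comps x v :=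
  funext fun i ↦ map_smul (coframe x i) c v

/-- The derivative of the components of a vector field. -/
def dComps (W : VField (𝓡 3) S3) (x : S3) (v : TangentSpace (𝓡 3) x) (k : Fin 3) : ℝ :=
  mvfderiv (𝓡 3) (fun y ↦ coframe y k (W y)) x v

theorem comps_mlieBracket {x : S3} {V W : VField (𝓡 3) S3}
    (hV : MDifferentiableAt (𝓡 3) (𝓡 3).tangent (fun x ↦ (V x : TangentBundle (𝓡 3) S3)) x)
    (hW : MDifferentiableAt (𝓡 3) (𝓡 3).tangent (fun x ↦ (W x : TangentBundle (𝓡 3) S3)) x) :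
    comps x (VectorField.mlieBracket (𝓡 3) V W x) =
      dComps W x (V x) - dComps V x (W x) + brk (comps x (V x)) (comps x (W x)) :=
  funext fun k ↦ coframe_mlieBracket hV hW k

/-- The Levi-Civita connection of `∑ aᵢ θᵢ²`, in components. -/
def nablaComp (a : Fin 3 → ℝ) (W : VField (𝓡 3) S3) (x : S3) (k : Fin 3) :
    TangentSpace (𝓡 3) x →L[ℝ] ℝ :=
  mvfderiv (𝓡 3) (fun y ↦ coframe y k (W y)) x +
    ∑ i, ∑ j, (christoffel a i j k * coframe x j (W x)) • coframe x i

theorem nablaComp_apply (a : Fin 3 → ℝ) (W : VField (𝓡 3) S3) (x : S3) (k : Fin 3)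
    (v : TangentSpace (𝓡 3) x) :
    nablaComp a W x k v = dComps W x v k + conn a (comps x v) (comps x (W x)) k := by
  simp only [nablaComp, _root_.add_apply, sum_apply, _root_.smul_apply, smul_eq_mul, dComps, conn, comps]
  congr 1
  exact Finset.sum_congr rfl fun i _ ↦ Finset.sum_congr rfl fun j _ ↦ by ring

/-- The Levi-Civita connection of `∑ aᵢ θᵢ²`. -/
def nabla (a : Fin 3 → ℝ) (W : VField (𝓡 3) S3) (x : S3) :
    TangentSpace (𝓡 3) x →L[ℝ] TangentSpace (𝓡 3) x :=
  ∑ k, (nablaComp a W x k).smulRight (frame k x)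

theorem comps_nabla (a : Fin 3 → ℝ) (W : VField (𝓡 3) S3) (x : S3) (v : TangentSpace (𝓡 3) x) :
    comps x (nabla a W x v) = dComps W x v + conn a (comps x v) (comps x (W x)) := by
  funext k
  rw [Pi.add_apply, ← nablaComp_apply]
  simp [comps, nabla, sum_apply, coframe_frame]

theorem eq_of_comps {x : S3} {v w : TangentSpace (𝓡 3) x} (h : comps x v = comps x w) : v = w :=
  eq_of_coframe fun i ↦ congrFun h i

theorem dComps_add {x : S3} {V W : VField (𝓡 3) S3}
    (hV : MDifferentiableAt (𝓡 3) (𝓡 3).tangent (fun x ↦ (V x : TangentBundle (𝓡 3) S3)) x)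
    (hW : MDifferentiableAt (𝓡 3) (𝓡 3).tangent (fun x ↦ (W x : TangentBundle (𝓡 3) S3)) x)
    (v : TangentSpace (𝓡 3) x) : dComps (V + W) x v = dComps V x v + dComps W x v := by
  funext k
  have h := mvfderiv_fun_add (mdifferentiableAt_coframe_apply hV k)
    (mdifferentiableAt_coframe_apply hW k)
  simp only [← map_add] at h
  exact congrArg (fun L : TangentSpace (𝓡 3) x →L[ℝ] ℝ ↦ L v) h

theorem dComps_smul {x : S3} {V : VField (𝓡 3) S3} {f : S3 → ℝ}
    (hV : MDifferentiableAt (𝓡 3) (𝓡 3).tangent (fun x ↦ (V x : TangentBundle (𝓡 3) S3)) x)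
    (hf : MDifferentiableAt (𝓡 3) 𝓘(ℝ, ℝ) f x) (v : TangentSpace (𝓡 3) x) :
    dComps (f • V) x v = f x • dComps V x v + mvfderiv (𝓡 3) f x v • comps x (V x) := by
  funext k
  have h := mvfderiv_fun_mul hf (mdifferentiableAt_coframe_apply hV k)
  have h1 : (fun y ↦ f y * coframe y k (V y)) = fun y ↦ coframe y k ((f • V) y) := by
    funext y
    simp
  rw [h1] at h
  have h2 := congrArg (fun L : TangentSpace (𝓡 3) x →L[ℝ] ℝ ↦ L v) h
  refine h2.trans ?_
  simp [dComps, comps, mul_comm]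

theorem isCovariantDerivativeOn_nabla (a : Fin 3 → ℝ) :
    IsCovariantDerivativeOn (I := 𝓡 3) (EuclideanSpace ℝ (Fin 3)) (nabla a) univ where
  add {V W x} hV hW _ := by
    ext1 v
    refine eq_of_comps ?_
    rw [_root_.add_apply, comps_add]
    simp only [comps_nabla, dComps_add hV hW, Pi.add_apply, comps_add]
    funext k
    simp only [Pi.add_apply, conn_add_right]
    ring
  leibniz {V f x} hV hf _ := by
    ext1 v
    refine eq_of_comps ?_
    rw [_root_.add_apply, comps_add, _root_.smul_apply, comps_smul,
      ContinuousLinearMap.smulRight_apply, comps_smul]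
    simp only [comps_nabla, dComps_smul hV hf]
    funext k
    simp only [Pi.add_apply, Pi.smul_apply', Pi.smul_apply, comps_smul, conn_smul_right, smul_eq_mul]
    ring

/-- The Levi-Civita connection of `∑ aᵢ θᵢ²`, as a covariant derivative. -/
def nablaCov (a : Fin 3 → ℝ) :
    CovariantDerivative (𝓡 3) (EuclideanSpace ℝ (Fin 3)) (TangentSpace (𝓡 3) : S3 → Type _) :=
  ⟨nabla a, isCovariantDerivativeOn_nabla a⟩

theorem mvfderiv_diagMetric_inner {a : Fin 3 → ℝ} (ha : ∀ i, 0 < a i) {x : S3}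
    {Y Z : VField (𝓡 3) S3}
    (hY : MDifferentiableAt (𝓡 3) (𝓡 3).tangent (fun x ↦ (Y x : TangentBundle (𝓡 3) S3)) x)
    (hZ : MDifferentiableAt (𝓡 3) (𝓡 3).tangent (fun x ↦ (Z x : TangentBundle (𝓡 3) S3)) x)
    (v : TangentSpace (𝓡 3) x) :
    mvfderiv (𝓡 3) (fun y ↦ (diagMetric a ha).inner y (Y y) (Z y)) x v =
      ∑ k, a k * (dComps Y x v k * comps x (Z x) k) + ∑ k, a k * (comps x (Y x) k * dComps Z x v k) := by
  simp only [diagMetric_inner]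
  have hY' := mdifferentiableAt_coframe_apply hY
  have hZ' := mdifferentiableAt_coframe_apply hZ
  have h1 : ∀ k, MDifferentiableAt (𝓡 3) 𝓘(ℝ, ℝ)
      (fun y ↦ coframe y k (Y y) * coframe y k (Z y)) x := fun k ↦ (hY' k).mul (hZ' k)
  have h2 : ∀ k, MDifferentiableAt (𝓡 3) 𝓘(ℝ, ℝ)
      (fun y ↦ a k * (coframe y k (Y y) * coframe y k (Z y))) x := fun k ↦
    mdifferentiableAt_const.mul (h1 k)
  rw [(mdifferentiableAt_and_mvfderiv_sum fun k _ ↦ h2 k).2, sum_apply, ← Finset.sum_add_distrib]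
  refine Finset.sum_congr rfl fun k _ ↦ ?_
  rw [mvfderiv_fun_mul mdifferentiableAt_const (h1 k), mvfderiv_const,
    mvfderiv_fun_mul (hY' k) (hZ' k)]
  simp [dComps, comps]
  ring

theorem isLeviCivita_nablaCov {a : Fin 3 → ℝ} (ha : ∀ i, 0 < a i) :
    IsLeviCivita (diagMetric a ha) (nablaCov a) where
  torsion_eq_zero := by
    rw [CovariantDerivative.torsion_eq_zero_iff]
    intro V W x hV hW
    refine eq_of_comps ?_
    rw [comps_mlieBracket hV hW, comps_sub]
    change comps x (nabla a W x (V x)) - comps x (nabla a V x (W x)) = _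
    rw [comps_nabla, comps_nabla]
    funext k
    simp only [Pi.add_apply, Pi.sub_apply, ← conn_sub_swap ha]
    ring
  compatible Y Z x hY hZ v := by
    refine (mvfderiv_diagMetric_inner ha hY hZ v).trans ?_
    rw [diagMetric_inner, diagMetric_inner]
    change _ = ∑ k, a k * (comps x (nabla a Y x v) k * comps x (Z x) k) +
      ∑ k, a k * (comps x (Y x) k * comps x (nabla a Z x v) k)
    have h := sum_conn_compatible ha (comps x v) (comps x (Y x)) (comps x (Z x))
    simp only [comps_nabla, Pi.add_apply, add_mul, mul_add, Finset.sum_add_distrib]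
    linear_combination -h

theorem comps_leviCivita {a : Fin 3 → ℝ} (ha : ∀ i, 0 < a i) {x : S3} {W : VField (𝓡 3) S3}
    (hW : MDifferentiableAt (𝓡 3) (𝓡 3).tangent (fun x ↦ (W x : TangentBundle (𝓡 3) S3)) x)
    (v : TangentSpace (𝓡 3) x) :
    comps x (leviCivita (diagMetric a ha) W x v) =
      dComps W x v + conn a (comps x v) (comps x (W x)) := by
  rw [leviCivita_eq (isLeviCivita_nablaCov ha) hW]
  exact comps_nabla a W x v

end Connection

/-! ### The curvature tensor in the left-invariant frame -/

section Curvature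

theorem mdifferentiableAt_of_coframe {x : S3} {W : VField (𝓡 3) S3}
    (h : ∀ k, MDifferentiableAt (𝓡 3) 𝓘(ℝ, ℝ) (fun y ↦ coframe y k (W y)) x) :
    MDifferentiableAt (𝓡 3) (𝓡 3).tangent (fun x ↦ (W x : TangentBundle (𝓡 3) S3)) x := by
  have h1 : W = (fun y ↦ coframe y 0 (W y)) • frame 0 + (fun y ↦ coframe y 1 (W y)) • frame 1 +
      (fun y ↦ coframe y 2 (W y)) • frame 2 := by
    funext y
    rw [← sum_coframe_frame y (W y), Fin.sum_univ_three]
    simp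
  have h2 := fun k ↦ (h k).smul_section (mdifferentiableAt_frame k x)
  rw [h1]
  exact mdifferentiableAt_add_section (mdifferentiableAt_add_section (h2 0) (h2 1)) (h2 2)

/-- The curvature `R(p,q)r` of `∑ aᵢ θᵢ²` in the left-invariant frame. -/
def curv (a p q r : Fin 3 → ℝ) : Fin 3 → ℝ :=
  conn a p (conn a q r) - conn a q (conn a p r) - conn a (brk p q) r

/-- The extensions used to define curvature need not be left-invariant, so all derivatives of
components are kept here; they cancel only in the curvature combination. -/
theorem comps_leviCivita_leviCivita {a : Fin 3 → ℝ} (ha : ∀ i, 0 < a i) {x : S3}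
    {X Y Z : VField (𝓡 3) S3}
    (hY : MDifferentiableAt (𝓡 3) (𝓡 3).tangent (fun x ↦ (Y x : TangentBundle (𝓡 3) S3)) x)
    (hZ : ContMDiffAt (𝓡 3) (𝓡 3).tangent 2 (fun x ↦ (Z x : TangentBundle (𝓡 3) S3)) x) (k : Fin 3) :
    comps x (leviCivita (diagMetric a ha)
      (fun y ↦ leviCivita (diagMetric a ha) Z y (Y y)) x (X x)) k =
      mvfderiv (𝓡 3) (fun y ↦ dComps Z y (Y y) k) x (X x)
      + conn a (dComps Y x (X x)) (comps x (Z x)) k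
      + conn a (comps x (Y x)) (dComps Z x (X x)) k
      + conn a (comps x (X x)) (dComps Z x (Y x)) k
      + conn a (comps x (X x)) (conn a (comps x (Y x)) (comps x (Z x))) k := by
  have hZ1 := hZ.mdifferentiableAt (by norm_num)
  -- The inner covariant derivative is differentiated again, so its formula is needed on a
  -- neighbourhood; `Z` being `C²` at `x` makes it differentiable nearby.
  have hev : ∀ᶠ y in 𝓝 x, ∀ k, coframe y k (leviCivita (diagMetric a ha) Z y (Y y)) =
      dComps Z y (Y y) k + conn a (comps y (Y y)) (comps y (Z y)) k := by
    have h1 : ∀ᶠ y in 𝓝 x, ContMDiffAt (𝓡 3) (𝓡 3).tangent 2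
        (fun x ↦ (Z x : TangentBundle (𝓡 3) S3)) y :=
      (contMDiffAt_iff_contMDiffAt_nhds (by simp)).1 hZ
    filter_upwards [h1] with y hy k
    exact congrFun (comps_leviCivita ha (hy.mdifferentiableAt (by norm_num)) (Y y)) k
  have hd : ∀ k, MDifferentiableAt (𝓡 3) 𝓘(ℝ, ℝ) (fun y ↦ dComps Z y (Y y) k) x := fun k ↦
    mdifferentiableAt_mvfderiv_apply (contMDiffAt_coframe_apply hZ k) hY
  have hY' := mdifferentiableAt_coframe_apply hY
  have hZ' := mdifferentiableAt_coframe_apply hZ1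
  have hYZ : ∀ i j, MDifferentiableAt (𝓡 3) 𝓘(ℝ, ℝ)
      (fun y ↦ coframe y i (Y y) * coframe y j (Z y)) x := fun i j ↦ (hY' i).mul (hZ' j)
  have hij : ∀ k i j, MDifferentiableAt (𝓡 3) 𝓘(ℝ, ℝ)
      (fun y ↦ christoffel a i j k * (coframe y i (Y y) * coframe y j (Z y))) x := fun k i j ↦
    mdifferentiableAt_const.mul (hYZ i j)
  have hi := fun k i ↦ mdifferentiableAt_and_mvfderiv_sum (s := Finset.univ) fun j _ ↦ hij k i j
  have hc := fun k ↦ mdifferentiableAt_and_mvfderiv_sum (s := Finset.univ) fun i _ ↦ (hi k i).1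
  have hsum := fun k ↦ (hd k).add (hc k).1
  have hN : MDifferentiableAt (𝓡 3) (𝓡 3).tangent
      (fun y ↦ (leviCivita (diagMetric a ha) Z y (Y y) : TangentBundle (𝓡 3) S3)) x :=
    mdifferentiableAt_of_coframe (W := fun y ↦ leviCivita (diagMetric a ha) Z y (Y y)) fun k ↦
      (hsum k).congr_of_eventuallyEq (hev.mono fun y hy ↦ hy k)
  rw [comps_leviCivita ha hN, Pi.add_apply]
  have h1 : comps x (leviCivita (diagMetric a ha) Z x (Y x)) =
      dComps Z x (Y x) + conn a (comps x (Y x)) (comps x (Z x)) := comps_leviCivita ha hZ1 _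
  rw [h1, conn_add_right]
  have h2 : dComps (fun y ↦ leviCivita (diagMetric a ha) Z y (Y y)) x (X x) k =
      mvfderiv (𝓡 3) (fun y ↦ dComps Z y (Y y) k) x (X x)
      + conn a (dComps Y x (X x)) (comps x (Z x)) k
      + conn a (comps x (Y x)) (dComps Z x (X x)) k := by
    have h3 : mvfderiv (𝓡 3) (fun y ↦ coframe y k (leviCivita (diagMetric a ha) Z y (Y y))) x =
        mvfderiv (𝓡 3) (fun y ↦ dComps Z y (Y y) k + ∑ i, ∑ j,
          christoffel a i j k * (coframe y i (Y y) * coframe y j (Z y))) x :=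
      Filter.EventuallyEq.mfderiv_eq (hev.mono fun y hy ↦ hy k)
    rw [dComps, h3, mvfderiv_fun_add (hd k) (hc k).1, (hc k).2, _root_.add_apply, sum_apply,
      add_assoc]
    congr 1
    simp only [conn, ← Finset.sum_add_distrib]
    refine Finset.sum_congr rfl fun i _ ↦ ?_
    rw [(hi k i).2, sum_apply]
    refine Finset.sum_congr rfl fun j _ ↦ ?_
    rw [mvfderiv_fun_mul mdifferentiableAt_const (hYZ i j), mvfderiv_const,
      mvfderiv_fun_mul (hY' i) (hZ' j)]
    simp [dComps, comps]
    ring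
  rw [h2]
  ring

/-- Tensoriality. Second derivatives of `Z` cancel against the derivative along `[X,Y]`, mixed
first-order terms are symmetric in `X` and `Y`, and the derivatives of `X` and `Y` are absorbed by
the components of `[X,Y]`. Only the algebraic part is left. -/
theorem comps_curvatureField {a : Fin 3 → ℝ} (ha : ∀ i, 0 < a i) {x : S3}
    {X Y Z : VField (𝓡 3) S3}
    (hX : MDifferentiableAt (𝓡 3) (𝓡 3).tangent (fun x ↦ (X x : TangentBundle (𝓡 3) S3)) x)
    (hY : MDifferentiableAt (𝓡 3) (𝓡 3).tangent (fun x ↦ (Y x : TangentBundle (𝓡 3) S3)) x)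
    (hZ : ContMDiffAt (𝓡 3) (𝓡 3).tangent 2 (fun x ↦ (Z x : TangentBundle (𝓡 3) S3)) x) :
    comps x (curvatureField (diagMetric a ha) X Y Z x) =
      curv a (comps x (X x)) (comps x (Y x)) (comps x (Z x)) := by
  funext k
  rw [curvatureField, comps_sub, comps_sub, Pi.sub_apply, Pi.sub_apply,
    comps_leviCivita_leviCivita ha hY hZ, comps_leviCivita_leviCivita ha hX hZ,
    comps_leviCivita ha (hZ.mdifferentiableAt (by norm_num)), comps_mlieBracket hX hY]
  have h : dComps Z x (VectorField.mlieBracket (𝓡 3) X Y x) k =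
      mvfderiv (𝓡 3) (fun y ↦ dComps Z y (Y y) k) x (X x) -
        mvfderiv (𝓡 3) (fun y ↦ dComps Z y (X y) k) x (Y x) :=
    mvfderiv_mlieBracket (contMDiffAt_coframe_apply hZ k) hX hY
  rw [Pi.add_apply, h, conn_add_left, conn_sub_left]
  simp only [curv, Pi.sub_apply]
  ring

theorem comps_curvature {a : Fin 3 → ℝ} (ha : ∀ i, 0 < a i) (x : S3)
    (u v w : TangentSpace (𝓡 3) x) :
    comps x (curvature (diagMetric a ha) x u v w) = curv a (comps x u) (comps x v) (comps x w) := by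
  have h := fun u : TangentSpace (𝓡 3) x ↦
    FiberBundle.contMDiffAt_extend (𝓡 3) (EuclideanSpace ℝ (Fin 3)) (k := 2) u
  have h1 := fun u ↦ (h u).mdifferentiableAt (by norm_num)
  refine (comps_curvatureField ha (h1 u) (h1 v) (h w)).trans ?_
  simp only [FiberBundle.extend_apply_self]

theorem inner_curvature {a : Fin 3 → ℝ} (ha : ∀ i, 0 < a i) (x : S3)
    (u v w z : TangentSpace (𝓡 3) x) :
    (diagMetric a ha).inner x (curvature (diagMetric a ha) x u v w) z =
      ∑ l, a l * (curv a (comps x u) (comps x v) (comps x w) l * comps x z l) := by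
  rw [diagMetric_inner, ← comps_curvature ha]
  rfl

end Curvature

/-! ### Ricci, scalar curvature and the norm of the curvature -/

section Ricci

theorem isLinearMap_curv_left (a q r : Fin 3 → ℝ) : IsLinearMap ℝ fun p ↦ curv a p q r where
  map_add p p' := by
    have h1 := funext (conn_add_left a p p' (conn a q r))
    have h2 := funext (conn_add_left a p p' r)
    have h3 : brk (p + p') q = brk p q + brk p' q := by
      funext k
      simp only [brk, Pi.add_apply, add_mul, mul_add, Finset.sum_add_distrib]
    funext k
    simp only [curv, h3, Pi.sub_apply, Pi.add_apply, conn_add_left]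
    rw [h2]
    have h4 := conn_add_right a q (conn a p r) (conn a p' r) k
    change _ - conn a q (conn a p r + conn a p' r) k - _ = _
    rw [h4]
    ring
  map_smul c p := by
    have h2 : conn a (c • p) r = c • conn a p r := funext (conn_smul_left a p r c)
    have h3 : brk (c • p) q = c • brk p q := by
      funext k
      simp only [brk, Pi.smul_apply, smul_eq_mul, Finset.mul_sum]
      exact Finset.sum_congr rfl fun i _ ↦ Finset.sum_congr rfl fun j _ ↦ by ring
    funext k
    simp only [curv, h2, h3, Pi.sub_apply, Pi.smul_apply, conn_smul_left, conn_smul_right, smul_eq_mul]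
    ring

theorem curv_swap (a p q r : Fin 3 → ℝ) : curv a p q r = -curv a q p r := by
  have h3 : brk p q = (-1 : ℝ) • brk q p := by
    funext k
    simp only [brk, Pi.smul_apply, smul_eq_mul, Fin.sum_univ_three, eps]
    ring
  funext k
  simp only [curv, h3, Pi.sub_apply, Pi.neg_apply, conn_smul_left]
  ring

theorem isLinearMap_curv_middle (a p r : Fin 3 → ℝ) : IsLinearMap ℝ fun q ↦ curv a p q r := by
  have h := (isLinearMap_curv_left a p r)
  refine ⟨fun q q' ↦ ?_, fun c q ↦ ?_⟩
  · rw [curv_swap a p, h.map_add, neg_add, ← curv_swap, ← curv_swap]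
  · rw [curv_swap a p, h.map_smul, ← smul_neg, ← curv_swap]

theorem isLinearMap_curv_right (a p q : Fin 3 → ℝ) : IsLinearMap ℝ fun r ↦ curv a p q r where
  map_add r r' := by
    have h : ∀ p, conn a p (r + r') = conn a p r + conn a p r' := fun p ↦
      funext (conn_add_right a p r r')
    funext k
    simp only [curv, h, Pi.sub_apply, Pi.add_apply, conn_add_right]
    ring
  map_smul c r := by
    have h : ∀ p, conn a p (c • r) = c • conn a p r := fun p ↦
      funext (conn_smul_right a p r c)
    funext k
    simp only [curv, h, Pi.sub_apply, Pi.smul_apply, conn_smul_right, smul_eq_mul]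
    ring

/-- The eigenvalues of the Ricci tensor of `∑ aᵢ θᵢ²` with respect to `∑ θᵢ²`. -/
def ricciCoeff (a : Fin 3 → ℝ) : Fin 3 → ℝ :=
  ![2 * (a 0 ^ 2 - (a 1 - a 2) ^ 2) / (a 1 * a 2), 2 * (a 1 ^ 2 - (a 2 - a 0) ^ 2) / (a 2 * a 0),
    2 * (a 2 ^ 2 - (a 0 - a 1) ^ 2) / (a 0 * a 1)]

/-- Ricci is the trace of `u ↦ R(u,q)r`, so it can be read off in the unnormalized frame. The
absence of off-diagonal terms is what lets the flow stay diagonal. -/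
theorem sum_curv {a : Fin 3 → ℝ} (ha : ∀ i, 0 < a i) (q r : Fin 3 → ℝ) :
    ∑ i, curv a (Pi.single i 1) q r i = ∑ i, ricciCoeff a i * (q i * r i) := by
  have h0 := (ha 0).ne'
  have h1 := (ha 1).ne'
  have h2 := (ha 2).ne'
  simp only [Fin.sum_univ_three, curv, Pi.sub_apply, conn_apply_zero, conn_apply_one,
    conn_apply_two, brk_apply_zero, brk_apply_one, brk_apply_two, ricciCoeff]
  simp
  field_simp
  ring

/-- An orthonormal basis for `∑ aᵢ θᵢ²`. -/
def diagBasis (a : Fin 3 → ℝ) (ha : ∀ i, 0 < a i) (x : S3) :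
    Basis (Fin 3) ℝ (TangentSpace (𝓡 3) x) :=
  Basis.ofEquivFun
    { toFun := fun v i ↦ √(a i) * comps x v i
      map_add' := fun v w ↦ by funext i; simp only [comps_add, Pi.add_apply, mul_add]
      map_smul' := fun c v ↦ by
        funext i
        simp only [comps_smul, Pi.smul_apply, smul_eq_mul, RingHom.id_apply]
        ring
      invFun := fun p ↦ ∑ i, ((√(a i))⁻¹ * p i) • frame i x
      left_inv := fun v ↦ by
        refine Eq.trans ?_ (sum_coframe_frame x v)
        refine Finset.sum_congr rfl fun i _ ↦ ?_
        rw [inv_mul_cancel_left₀ (Real.sqrt_pos.2 (ha i)).ne']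
        rfl
      right_inv := fun p ↦ by
        funext i
        simp [comps, coframe_frame, (Real.sqrt_pos.2 (ha i)).ne'] }

theorem comps_diagBasis (a : Fin 3 → ℝ) (ha : ∀ i, 0 < a i) (x : S3) (i : Fin 3) :
    comps x (diagBasis a ha x i) = Pi.single i (√(a i))⁻¹ := by
  have h : diagBasis a ha x i = ∑ j, ((√(a j))⁻¹ * (Pi.single i 1 : Fin 3 → ℝ) j) • frame j x := by
    simp only [diagBasis, Basis.coe_ofEquivFun]
    rfl
  rw [h]
  funext k
  simp [comps, coframe_frame, Pi.single_apply]

theorem inner_diagBasis (a : Fin 3 → ℝ) (ha : ∀ i, 0 < a i) (x : S3) (i j : Fin 3) :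
    (diagMetric a ha).inner x (diagBasis a ha x i) (diagBasis a ha x j) = if i = j then 1 else 0 := by
  rw [diagMetric_inner]
  change ∑ k, a k * (comps x _ k * comps x _ k) = _
  rw [comps_diagBasis, comps_diagBasis]
  rcases eq_or_ne i j with rfl | hij
  · simp only [Pi.single_apply, if_true, mul_ite, mul_zero, ite_mul, zero_mul]
    rw [Finset.sum_eq_single i (fun k _ hk ↦ by simp [hk]) (by simp)]
    rw [if_pos rfl, ← mul_inv, Real.mul_self_sqrt (ha i).le, mul_inv_cancel₀ (ha i).ne', if_pos rfl]
  · rw [if_neg hij]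
    refine Finset.sum_eq_zero fun k _ ↦ ?_
    simp only [Pi.single_apply]
    split_ifs with h1 h2 <;> simp_all

/-- The inner product of a metric at a point, as a bilinear map. -/
abbrev innerBilin (g : SmoothMetric (𝓡 3) S3) (x : S3) :
    TangentSpace (𝓡 3) x →ₗ[ℝ] TangentSpace (𝓡 3) x →ₗ[ℝ] ℝ :=
  LinearMap.mk₂ ℝ (fun v w ↦ g.inner x v w) (by simp) (by simp) (by simp) (by simp)

theorem sum_orthonormalFrame_eq {a : Fin 3 → ℝ} (ha : ∀ i, 0 < a i) (x : S3)
    (B : TangentSpace (𝓡 3) x →ₗ[ℝ] TangentSpace (𝓡 3) x →ₗ[ℝ] ℝ) :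
    ∑ i, B (orthonormalFrame (diagMetric a ha) x i) (orthonormalFrame (diagMetric a ha) x i) =
      ∑ i, B (diagBasis a ha x i) (diagBasis a ha x i) :=
  sum_bilin_orthonormal (G := innerBilin (diagMetric a ha) x)
    (fun v w ↦ (diagMetric a ha).symm x v w) (inner_orthonormalFrame (diagMetric a ha) x)
    (inner_diagBasis a ha x) B

theorem ricci_diagMetric {a : Fin 3 → ℝ} (ha : ∀ i, 0 < a i) (x : S3)
    (v w : TangentSpace (𝓡 3) x) :
    ricci (diagMetric a ha) x v w = ∑ i, ricciCoeff a i * (comps x v i * comps x w i) := by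
  have hl := isLinearMap_curv_left a (comps x v) (comps x w)
  let B : TangentSpace (𝓡 3) x →ₗ[ℝ] TangentSpace (𝓡 3) x →ₗ[ℝ] ℝ :=
    LinearMap.mk₂ ℝ (fun u z ↦ ∑ l, a l * (curv a (comps x u) (comps x v) (comps x w) l * comps x z l))
      (fun u u' z ↦ by
        rw [comps_add, hl.map_add]
        simp only [Pi.add_apply, add_mul, mul_add, Finset.sum_add_distrib])
      (fun c u z ↦ by
        rw [comps_smul, hl.map_smul]
        simp only [Pi.smul_apply, smul_eq_mul, Finset.mul_sum]
        exact Finset.sum_congr rfl fun i _ ↦ by ring)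
      (fun u z z' ↦ by simp only [comps_add, Pi.add_apply, mul_add, Finset.sum_add_distrib])
      (fun c u z ↦ by
        simp only [comps_smul, Pi.smul_apply, smul_eq_mul, Finset.mul_sum]
        exact Finset.sum_congr rfl fun i _ ↦ by ring)
  have h := sum_orthonormalFrame_eq ha x B
  rw [← sum_curv ha]
  refine Eq.trans ?_ (h.trans ?_)
  · exact Finset.sum_congr rfl fun i _ ↦ inner_curvature ha x _ _ _ _
  · refine Finset.sum_congr rfl fun i _ ↦ ?_
    simp only [B, LinearMap.mk₂_apply, comps_diagBasis]
    have h1 : (Pi.single i (√(a i))⁻¹ : Fin 3 → ℝ) = (√(a i))⁻¹ • Pi.single i 1 := by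
      rw [← Pi.single_smul, smul_eq_mul, mul_one]
    rw [Finset.sum_eq_single i (fun k _ hk ↦ by simp [hk]) (by simp), h1, hl.map_smul]
    simp only [Pi.smul_apply, smul_eq_mul, Pi.single_eq_same, mul_one]
    have h2 : a i * ((√(a i))⁻¹ * (√(a i))⁻¹) = 1 := by
      rw [← mul_inv, Real.mul_self_sqrt (ha i).le, mul_inv_cancel₀ (ha i).ne']
    linear_combination curv a (Pi.single i 1) (comps x v) (comps x w) i * h2

theorem scal_diagMetric {a : Fin 3 → ℝ} (ha : ∀ i, 0 < a i) (x : S3) :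
    scal (diagMetric a ha) x = ∑ i, ricciCoeff a i / a i := by
  let B : TangentSpace (𝓡 3) x →ₗ[ℝ] TangentSpace (𝓡 3) x →ₗ[ℝ] ℝ :=
    LinearMap.mk₂ ℝ (fun v w ↦ ∑ i, ricciCoeff a i * (comps x v i * comps x w i))
      (fun u u' z ↦ by simp only [comps_add, Pi.add_apply, add_mul, mul_add, Finset.sum_add_distrib])
      (fun c u z ↦ by
        simp only [comps_smul, Pi.smul_apply, smul_eq_mul, Finset.mul_sum]
        exact Finset.sum_congr rfl fun i _ ↦ by ring)
      (fun u z z' ↦ by simp only [comps_add, Pi.add_apply, mul_add, Finset.sum_add_distrib])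
      (fun c u z ↦ by
        simp only [comps_smul, Pi.smul_apply, smul_eq_mul, Finset.mul_sum]
        exact Finset.sum_congr rfl fun i _ ↦ by ring)
  refine Eq.trans ?_ ((sum_orthonormalFrame_eq ha x B).trans ?_)
  · exact Finset.sum_congr rfl fun i _ ↦ ricci_diagMetric ha x _ _
  · refine Finset.sum_congr rfl fun i _ ↦ ?_
    simp only [B, LinearMap.mk₂_apply, comps_diagBasis]
    rw [Finset.sum_eq_single i (fun k _ hk ↦ by simp [hk]) (by simp), Pi.single_eq_same,
      ← mul_inv, Real.mul_self_sqrt (ha i).le, div_eq_mul_inv]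

/-- The norm of the curvature tensor of `∑ aᵢ θᵢ²`. -/
def curvNorm (a : Fin 3 → ℝ) : ℝ :=
  √(∑ i, ∑ j, ∑ k, ∑ l, (a l * curv a (Pi.single i 1) (Pi.single j 1) (Pi.single k 1) l *
    ((√(a i))⁻¹ * (√(a j))⁻¹ * (√(a k))⁻¹ * (√(a l))⁻¹)) ^ 2)

theorem normRm_diagMetric {a : Fin 3 → ℝ} (ha : ∀ i, 0 < a i) (x : S3) :
    normRm (diagMetric a ha) x = curvNorm a := by
  let R : TangentSpace (𝓡 3) x → TangentSpace (𝓡 3) x → TangentSpace (𝓡 3) x →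
      TangentSpace (𝓡 3) x → ℝ := fun u v w z ↦
    ∑ l, a l * (curv a (comps x u) (comps x v) (comps x w) l * comps x z l)
  have key : ∀ {f : TangentSpace (𝓡 3) x → Fin 3 → ℝ} (z : TangentSpace (𝓡 3) x),
      (∀ v w, f (v + w) = f v + f w) → (∀ (c : ℝ) v, f (c • v) = c • f v) →
      IsLinearMap ℝ fun v ↦ ∑ l, a l * (f v l * comps x z l) := by
    intro f z h1 h2
    refine ⟨fun v w ↦ ?_, fun c v ↦ ?_⟩
    · simp only [h1, Pi.add_apply, add_mul, mul_add, Finset.sum_add_distrib]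
    · simp only [h2, Pi.smul_apply, smul_eq_mul, Finset.mul_sum]
      exact Finset.sum_congr rfl fun i _ ↦ by ring
  have h := sum_sq_tensor_orthonormal (G := innerBilin (diagMetric a ha) x)
    (fun v w ↦ (diagMetric a ha).symm x v w) (inner_orthonormalFrame (diagMetric a ha) x)
    (inner_diagBasis a ha x) (R := R)
    (fun v w z ↦ key z (fun u u' ↦ by rw [comps_add, (isLinearMap_curv_left a _ _).map_add])
      fun c u ↦ by rw [comps_smul, (isLinearMap_curv_left a _ _).map_smul])
    (fun u w z ↦ key z (fun v v' ↦ by rw [comps_add, (isLinearMap_curv_middle a _ _).map_add])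
      fun c v ↦ by rw [comps_smul, (isLinearMap_curv_middle a _ _).map_smul])
    (fun u v z ↦ key z (fun w w' ↦ by rw [comps_add, (isLinearMap_curv_right a _ _).map_add])
      fun c w ↦ by rw [comps_smul, (isLinearMap_curv_right a _ _).map_smul])
    (fun u v w ↦ ⟨fun z z' ↦ by
        simp only [R, comps_add, Pi.add_apply, mul_add, Finset.sum_add_distrib], fun c z ↦ by
        simp only [R, comps_smul, Pi.smul_apply, smul_eq_mul, Finset.mul_sum]
        exact Finset.sum_congr rfl fun i _ ↦ by ring⟩)
  rw [normRm, curvNorm]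
  refine congrArg Real.sqrt (Eq.trans ?_ (h.trans ?_))
  · refine Finset.sum_congr rfl fun i _ ↦ Finset.sum_congr rfl fun j _ ↦ Finset.sum_congr rfl fun k _ ↦
      Finset.sum_congr rfl fun l _ ↦ congrArg (· ^ 2) (inner_curvature ha x _ _ _ _)
  · refine Finset.sum_congr rfl fun i _ ↦ Finset.sum_congr rfl fun j _ ↦ Finset.sum_congr rfl fun k _ ↦
      Finset.sum_congr rfl fun l _ ↦ congrArg (· ^ 2) ?_
    have h1 : ∀ i, (Pi.single i (√(a i))⁻¹ : Fin 3 → ℝ) = (√(a i))⁻¹ • Pi.single i 1 := fun i ↦ by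
      rw [← Pi.single_smul, smul_eq_mul, mul_one]
    simp only [R, comps_diagBasis]
    rw [Finset.sum_eq_single l (fun k _ hk ↦ by simp [hk]) (by simp), h1 i, h1 j, h1 k,
      (isLinearMap_curv_left a _ _).map_smul, (isLinearMap_curv_middle a _ _).map_smul,
      (isLinearMap_curv_right a _ _).map_smul]
    simp only [Pi.smul_apply, smul_eq_mul, Pi.single_eq_same]
    ring

/-- The connection is unchanged by scaling. The covariant curvature tensor gains a factor `c`, and
each of its four orthonormal arguments a factor `1/√c`. -/
theorem curvNorm_smul {c : ℝ} (hc : 0 < c) (a : Fin 3 → ℝ) : curvNorm (c • a) = c⁻¹ * curvNorm a := by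
  have h1 : ∀ p q, conn (c • a) p q = conn a p q := by
    intro p q
    funext k
    simp only [conn, christoffel, Pi.smul_apply, smul_eq_mul]
    refine Finset.sum_congr rfl fun i _ ↦ Finset.sum_congr rfl fun j _ ↦ ?_
    rw [show eps i j k * (c * a k + c * a j - c * a i) = c * (eps i j k * (a k + a j - a i)) by ring,
      mul_div_mul_left _ _ hc.ne']
  have h2 : ∀ p q r, curv (c • a) p q r = curv a p q r := fun p q r ↦ by simp only [curv, h1]
  have h3 : (√c)⁻¹ * (√c)⁻¹ = c⁻¹ := by rw [← mul_inv, Real.mul_self_sqrt hc.le]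
  rw [← Real.sqrt_sq (inv_pos.2 hc).le, curvNorm, curvNorm, ← Real.sqrt_mul (sq_nonneg _)]
  congr 1
  simp only [Finset.mul_sum]
  refine Finset.sum_congr rfl fun i _ ↦ Finset.sum_congr rfl fun j _ ↦ Finset.sum_congr rfl fun k _ ↦
      Finset.sum_congr rfl fun l _ ↦ ?_
  simp only [h2, Pi.smul_apply, smul_eq_mul, Real.sqrt_mul hc.le, mul_inv]
  rw [← mul_pow]
  congr 1
  set s := (√c)⁻¹
  have h4 : c * c⁻¹ = 1 := mul_inv_cancel₀ hc.ne'
  have h5 : c * (s * s * (s * s)) = c⁻¹ := by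
    rw [h3]
    linear_combination c⁻¹ * h4
  rw [← h5]
  ring

/-- The left side is the sectional curvature of the plane spanned by the frame vectors `0` and `2`,
that is the single component `R₀₂₂₀`; all other terms of the sum of squares are dropped. -/
theorem le_curvNorm {a : Fin 3 → ℝ} (ha : ∀ i, 0 < a i) :
    (a 0 ^ 2 - 3 * a 1 ^ 2 + 2 * a 1 * a 2 + 2 * a 0 * a 1 - 2 * a 0 * a 2 + a 2 ^ 2) /
      (a 0 * a 1 * a 2) ≤ curvNorm a := by
  have h0 := ha 0
  have h1 := ha 1
  have h2 := ha 2
  refine Real.le_sqrt_of_sq_le ?_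
  have hp : ∀ (F : Fin 3 → ℝ) (i : Fin 3), (∀ i, 0 ≤ F i) → F i ≤ ∑ i, F i := fun F i hF ↦
    Finset.single_le_sum (fun j _ ↦ hF j) (Finset.mem_univ i)
  refine le_trans ?_ (hp _ 0 fun i ↦ by positivity)
  refine le_trans ?_ (hp _ 2 fun i ↦ by positivity)
  refine le_trans ?_ (hp _ 2 fun i ↦ by positivity)
  refine le_trans ?_ (hp _ 0 fun i ↦ by positivity)
  refine le_of_eq (congrArg (· ^ 2) ?_)
  have h3 : (√(a 0))⁻¹ * (√(a 2))⁻¹ * (√(a 2))⁻¹ * (√(a 0))⁻¹ = (a 0 * a 2)⁻¹ := by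
    rw [show (√(a 0))⁻¹ * (√(a 2))⁻¹ * (√(a 2))⁻¹ * (√(a 0))⁻¹ = (√(a 0) * √(a 0))⁻¹ * (√(a 2) * √(a 2))⁻¹ by
      rw [mul_inv, mul_inv]; ring, Real.mul_self_sqrt h0.le, Real.mul_self_sqrt h2.le, mul_inv]
  rw [h3]
  simp only [curv, Pi.sub_apply, conn_apply_zero, conn_apply_one,
    conn_apply_two, brk_apply_one, brk_apply_two]
  simp
  field_simp
  ring

end Ricci

/-! ### Autonomous ODEs: uniqueness, maximal solutions, extension, smoothness -/

section ODE

/-- `a` solves the autonomous equation `a' = f(a)` on `[0,T)`, inside `U`. -/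
structure IsSolutionOn {E : Type*} [NormedAddCommGroup E] [NormedSpace ℝ E] (f : E → E) (U : Set E)
    (a : ℝ → E) (T : ℝ) : Prop where
  hasDeriv : ∀ t ∈ Ico 0 T, HasDerivWithinAt a (f (a t)) (Ici 0) t
  mem : ∀ t ∈ Ico 0 T, a t ∈ U

variable {E : Type*} [NormedAddCommGroup E] [NormedSpace ℝ E] {f : E → E} {U : Set E}

theorem IsSolutionOn.mono {a : ℝ → E} {T T' : ℝ} (h : IsSolutionOn f U a T) (hT : T' ≤ T) :
    IsSolutionOn f U a T' :=
  ⟨fun t ht ↦ h.hasDeriv t ⟨ht.1, ht.2.trans_le hT⟩, fun t ht ↦ h.mem t ⟨ht.1, ht.2.trans_le hT⟩⟩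

theorem IsSolutionOn.continuousOn {a : ℝ → E} {T : ℝ} (h : IsSolutionOn f U a T) :
    ContinuousOn a (Ico 0 T) := fun t ht ↦
  (h.hasDeriv t ht).continuousWithinAt.mono Ico_subset_Ici_self

theorem IsSolutionOn.hasDerivAt {a : ℝ → E} {T : ℝ} (h : IsSolutionOn f U a T) {t : ℝ}
    (ht : t ∈ Ioo 0 T) : HasDerivAt a (f (a t)) t :=
  (h.hasDeriv t ⟨ht.1.le, ht.2⟩).hasDerivAt (Ici_mem_nhds ht.1)

/-- Over `[0,t]` both trajectories fill a compact subset of `U`, on which the `C¹` field is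
Lipschitz, so the standard uniqueness theorem applies. -/
theorem IsSolutionOn.eqOn (hU : IsOpen U) (hf : ContDiffOn ℝ 1 f U) {a b : ℝ → E} {T : ℝ}
    (ha : IsSolutionOn f U a T) (hb : IsSolutionOn f U b T) (h0 : a 0 = b 0) :
    EqOn a b (Ico 0 T) := by
  intro t ht
  have hsub : Icc 0 t ⊆ Ico 0 T := fun s hs ↦ ⟨hs.1, hs.2.trans_lt ht.2⟩
  have hac := ha.continuousOn.mono hsub
  have hbc := hb.continuousOn.mono hsub
  let K : Set E := a '' Icc 0 t ∪ b '' Icc 0 t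
  have hK : IsCompact K := (isCompact_Icc.image_of_continuousOn hac).union
    (isCompact_Icc.image_of_continuousOn hbc)
  have hKU : K ⊆ U := by
    rintro _ (⟨s, hs, rfl⟩ | ⟨s, hs, rfl⟩)
    exacts [ha.mem s (hsub hs), hb.mem s (hsub hs)]
  have hloc : LocallyLipschitzOn K f := by
    intro x hx
    obtain ⟨L, V, hV, hL⟩ := (hf.contDiffAt (hU.mem_nhds (hKU hx))).exists_lipschitzOnWith
    exact ⟨L, V, mem_nhdsWithin_of_mem_nhds hV, hL⟩
  obtain ⟨L, hL⟩ := hloc.exists_lipschitzOnWith_of_compact hK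
  have hsub' : Ico 0 t ⊆ Icc 0 t := Ico_subset_Icc_self
  refine ODE_solution_unique_of_mem_Icc_right (v := fun _ ↦ f) (s := fun _ ↦ K) (K := L)
    (fun _ _ ↦ hL) hac (fun s hs ↦ ?_) (fun s hs ↦ ?_) hbc (fun s hs ↦ ?_) (fun s hs ↦ ?_) h0
    (right_mem_Icc.2 ht.1)
  · exact (ha.hasDeriv s (hsub (hsub' hs))).mono (Ici_subset_Ici.2 hs.1)
  · exact Or.inl (mem_image_of_mem a (hsub' hs))
  · exact (hb.hasDeriv s (hsub (hsub' hs))).mono (Ici_subset_Ici.2 hs.1)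
  · exact Or.inr (mem_image_of_mem b (hsub' hs))

variable [CompleteSpace E]

theorem exists_isSolutionOn (hU : IsOpen U) (hf : ContDiffOn ℝ 1 f U) {x₀ : E} (hx₀ : x₀ ∈ U) :
    ∃ T > 0, ∃ a : ℝ → E, a 0 = x₀ ∧ IsSolutionOn f U a T := by
  obtain ⟨a, ha0, ε, hε, ha⟩ :=
    (hf.contDiffAt (hU.mem_nhds hx₀)).exists_forall_mem_closedBall_exists_eq_forall_mem_Ioo_hasDerivAt₀ 0
  have hc : ContinuousAt a 0 := (ha 0 ⟨by linarith, by linarith⟩).continuousAt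
  have hev : ∀ᶠ t in 𝓝 (0 : ℝ), a t ∈ U := hc (hU.mem_nhds (by rwa [ha0]))
  obtain ⟨δ, hδ, h⟩ := Metric.eventually_nhds_iff.1 hev
  refine ⟨min ε δ, lt_min hε hδ, a, ha0, fun t ht ↦ (ha t ⟨by linarith [ht.1], ?_⟩).hasDerivWithinAt,
    fun t ht ↦ h ?_⟩
  · linarith [ht.2.trans_le (min_le_left ε δ)]
  · rw [Real.dist_eq, sub_zero, abs_of_nonneg ht.1]
    exact ht.2.trans_le (min_le_right ε δ)

/-- A maximal solution exists if the life spans of solutions are bounded. -/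
theorem exists_maximal_isSolutionOn (hU : IsOpen U) (hf : ContDiffOn ℝ 1 f U)
    {x₀ : E} (hx₀ : x₀ ∈ U) {L : ℝ}
    (hL : ∀ (T : ℝ) (a : ℝ → E), 0 < T → a 0 = x₀ → IsSolutionOn f U a T → T ≤ L) :
    ∃ T > 0, ∃ a : ℝ → E, a 0 = x₀ ∧ IsSolutionOn f U a T ∧
      ∀ T' > T, ∀ b : ℝ → E, b 0 = x₀ → ¬ IsSolutionOn f U b T' := by
  let S : Set ℝ := {T | 0 < T ∧ ∃ a : ℝ → E, a 0 = x₀ ∧ IsSolutionOn f U a T}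
  obtain ⟨T₀, hT₀, a₀, ha₀, hs₀⟩ := exists_isSolutionOn hU hf hx₀
  have hne : S.Nonempty := ⟨T₀, hT₀, a₀, ha₀, hs₀⟩
  have hbdd : BddAbove S := ⟨L, fun T hT ↦ hL T _ hT.1 hT.2.choose_spec.1 hT.2.choose_spec.2⟩
  have hpos : 0 < sSup S := hT₀.trans_le (le_csSup hbdd ⟨hT₀, a₀, ha₀, hs₀⟩)
  have hex : ∀ t, t < sSup S → ∃ a : ℝ → E, ∃ T, t < T ∧ 0 < T ∧ a 0 = x₀ ∧ IsSolutionOn f U a T := by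
    intro t ht
    obtain ⟨T, hT, htT⟩ := exists_lt_of_lt_csSup hne ht
    exact ⟨hT.2.choose, T, htT, hT.1, hT.2.choose_spec⟩
  choose! α τ hα using hex
  -- Here `α t` is a solution living beyond time `t`. By uniqueness the diagonal choice agrees with
  -- `α t` near `t`, so it is itself a solution up to the supremum of the life spans.
  let a : ℝ → E := fun t ↦ α t t
  have heq : ∀ t < sSup S, EqOn a (α t) (Ico 0 (min (τ t) (sSup S))) := by
    intro t ht s hs
    have hs' := hs.2.trans_le (min_le_right _ _)
    have h1 := (hα s hs').2.2
    have h2 := (hα t ht).2.2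
    refine IsSolutionOn.eqOn hU hf (h1.2.mono (min_le_left _ (τ t))) (h2.2.mono (min_le_right (τ s) _))
      (h1.1.trans h2.1.symm) ⟨hs.1, lt_min (hα s hs').1 (hs.2.trans_le (min_le_left _ _))⟩
  refine ⟨sSup S, hpos, a, (hα 0 hpos).2.2.1, ⟨fun t ht ↦ ?_, fun t ht ↦ ?_⟩, ?_⟩
  · have hlt : t < min (τ t) (sSup S) := lt_min (hα t ht.2).1 ht.2
    have hev : a =ᶠ[𝓝[Ici 0] t] α t := by
      filter_upwards [mem_nhdsWithin_of_mem_nhds (Iio_mem_nhds hlt), self_mem_nhdsWithin] with s hs hs0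
      exact heq t ht.2 ⟨hs0, hs⟩
    exact ((hα t ht.2).2.2.2.hasDeriv t ⟨ht.1, (hα t ht.2).1⟩).congr_of_eventuallyEq hev rfl
  · exact (hα t ht.2).2.2.2.mem t ⟨ht.1, (hα t ht.2).1⟩
  · intro T' hT' b hb0 hb
    exact hT'.not_ge (le_csSup hbdd ⟨hpos.trans hT', b, hb0, hb⟩)

/-- A solution with a limit inside `U` extends. -/
theorem IsSolutionOn.exists_extension (hU : IsOpen U) (hf : ContDiffOn ℝ 1 f U) {a : ℝ → E} {T : ℝ}
    (hT : 0 < T) (ha : IsSolutionOn f U a T) {y : E} (hy : y ∈ U) (hlim : Tendsto a (𝓝[<] T) (𝓝 y)) :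
    ∃ T' > T, ∃ b : ℝ → E, b 0 = a 0 ∧ IsSolutionOn f U b T' := by
  obtain ⟨ε, hε, c, hc0, hc⟩ := exists_isSolutionOn hU hf hy
  let b : ℝ → E := fun t ↦ if t < T then a t else c (t - T)
  have hb1 : ∀ t < T, b t = a t := fun t ht ↦ if_pos ht
  have hb2 : ∀ t, T ≤ t → b t = c (t - T) := fun t ht ↦ if_neg ht.not_gt
  have hbT : b T = y := by rw [hb2 T le_rfl, sub_self, hc0]
  have hev1 : ∀ t < T, b =ᶠ[𝓝 t] a := fun t ht ↦ (eventually_lt_nhds ht).mono hb1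
  have hcd : ∀ t ∈ Ico T (T + ε), HasDerivWithinAt b (f (b t)) (Ici T) t := by
    intro t ht
    have h1 := hc.hasDeriv (t - T) ⟨sub_nonneg.2 ht.1, by linarith [ht.2]⟩
    have h2 : HasDerivWithinAt (fun s ↦ s - T) 1 (Ici T) t := ((hasDerivAt_id t).sub_const T).hasDerivWithinAt
    have h3 := HasDerivWithinAt.scomp t h1 h2 (fun s hs ↦ sub_nonneg.2 hs)
    rw [one_smul] at h3
    rw [hb2 t ht.1]
    exact h3.congr (fun s hs ↦ hb2 s hs) (hb2 t ht.1)
  -- At the junction the left derivative exists because `b` is continuous there and `b' = f(a)`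
  -- converges to `f(y)`; it matches the right derivative of the restarted solution.
  have hleft : HasDerivWithinAt b (f (b T)) (Iic T) T := by
    have hnear : Ioo 0 T ∈ 𝓝[<] T := Ioo_mem_nhdsLT hT
    have hd : ∀ t ∈ Ioo 0 T, HasDerivAt b (f (a t)) t := fun t ht ↦
      (ha.hasDerivAt ht).congr_of_eventuallyEq (hev1 t ht.2)
    refine hasDerivWithinAt_Iic_of_tendsto_deriv (s := Ioo 0 T)
      (fun t ht ↦ (hd t ht).differentiableAt.differentiableWithinAt) ?_ hnear ?_
    · rw [ContinuousWithinAt, hbT]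
      refine (hlim.mono_left (nhdsWithin_mono T fun t ht ↦ ht.2)).congr' ?_
      filter_upwards [self_mem_nhdsWithin] with t ht using (hb1 t ht.2).symm
    · rw [hbT]
      refine ((((hf.contDiffAt (hU.mem_nhds hy)).continuousAt).tendsto.comp hlim)).congr' ?_
      filter_upwards [hnear] with t ht using (hd t ht).deriv.symm
  refine ⟨T + ε, by linarith, b, hb1 0 hT, fun t ht ↦ ?_, fun t ht ↦ ?_⟩
  · rcases lt_trichotomy t T with h | rfl | h
    · rw [hb1 t h]
      exact (ha.hasDeriv t ⟨ht.1, h⟩).congr_of_eventuallyEq (mem_nhdsWithin_of_mem_nhds (hev1 t h)) (hb1 t h)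
    · have h1 := hleft.union (hcd t ⟨le_rfl, ht.2⟩)
      rw [Iic_union_Ici] at h1
      exact h1.mono (subset_univ _)
    · exact ((hcd t ⟨h.le, ht.2⟩).hasDerivAt (Ici_mem_nhds h)).hasDerivWithinAt
  · rcases lt_or_ge t T with h | h
    · rw [hb1 t h]
      exact ha.mem t ⟨ht.1, h⟩
    · rw [hb2 t h]
      exact hc.mem _ ⟨sub_nonneg.2 h, by linarith [ht.2]⟩

theorem IsSolutionOn.contDiffOn (hf : ContDiffOn ℝ ∞ f U) {a : ℝ → E} {T : ℝ}
    (ha : IsSolutionOn f U a T) : ContDiffOn ℝ ∞ a (Ico 0 T) := by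
  intro t ht
  obtain ⟨s, hts, hsT⟩ := exists_between ht.2
  have hsub : Icc 0 s ⊆ Ico 0 T := fun r hr ↦ ⟨hr.1, hr.2.trans_lt hsT⟩
  have h := ODE.contDiffOn_enat_Icc_of_hasDerivWithinAt (f := fun _ : ℝ ↦ f) (u := U) (tmin := 0) (tmax := s)
    (α := a) (n := ⊤) (hf.comp contDiffOn_snd fun p hp ↦ hp.2)
    (fun r hr ↦ (ha.hasDeriv r (hsub hr)).mono Icc_subset_Ici_self) (fun r hr ↦ ha.mem r (hsub hr))
  refine (h t ⟨ht.1, hts.le⟩).mono_of_mem_nhdsWithin ?_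
  filter_upwards [mem_nhdsWithin_of_mem_nhds (Iio_mem_nhds hts), self_mem_nhdsWithin] with r hr hr'
  exact ⟨hr'.1, le_of_lt hr⟩

end ODE

/-! ### Comparison principles on a half-open interval -/

section Comparison

theorem monotone_of_hasDerivWithinAt_nonneg {u u' : ℝ → ℝ} {T : ℝ}
    (hu : ∀ t ∈ Ico 0 T, HasDerivWithinAt u (u' t) (Ici 0) t) (hu' : ∀ t ∈ Ico 0 T, 0 ≤ u' t) {t : ℝ}
    (ht : t ∈ Ico 0 T) : u 0 ≤ u t := by
  have hsub : Icc 0 t ⊆ Ico 0 T := fun s hs ↦ ⟨hs.1, hs.2.trans_lt ht.2⟩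
  have hd : ∀ s ∈ Ioo 0 t, HasDerivAt u (u' s) s := fun s hs ↦
    (hu s (hsub ⟨hs.1.le, hs.2.le⟩)).hasDerivAt (Ici_mem_nhds hs.1)
  refine monotoneOn_of_deriv_nonneg (convex_Icc 0 t) (fun s hs ↦
    (hu s (hsub hs)).continuousWithinAt.mono Icc_subset_Ici_self) (fun s hs ↦ ?_) (fun s hs ↦ ?_)
    ⟨le_rfl, ht.1⟩ ⟨ht.1, le_rfl⟩ ht.1
  · rw [interior_Icc] at hs
    exact (hd s hs).differentiableAt.differentiableWithinAt
  · rw [interior_Icc] at hs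
    rw [(hd s hs).deriv]
    exact hu' s (hsub ⟨hs.1.le, hs.2.le⟩)

/-- A solution of `u' = c u` cannot reach zero: with `|c| ≤ K` on a compact interval, `u² exp(2Kt)`
is nondecreasing. Positivity then follows from the intermediate value theorem. -/
theorem pos_of_hasDerivWithinAt_mul {u c : ℝ → ℝ} {T : ℝ}
    (hu : ∀ t ∈ Ico 0 T, HasDerivWithinAt u (c t * u t) (Ici 0) t) (hc : ContinuousOn c (Ico 0 T))
    (h0 : 0 < u 0) {t : ℝ} (ht : t ∈ Ico 0 T) : 0 < u t := by
  have hne : ∀ t ∈ Ico 0 T, u t ≠ 0 := by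
    intro t ht hut
    obtain ⟨r, htr, hrT⟩ := exists_between ht.2
    have hsub : Ico 0 r ⊆ Ico 0 T := Ico_subset_Ico_right hrT.le
    have hsub' : Icc 0 r ⊆ Ico 0 T := fun s hs ↦ ⟨hs.1, hs.2.trans_lt hrT⟩
    obtain ⟨K, hK⟩ := isCompact_Icc.exists_bound_of_continuousOn (hc.mono hsub')
    have h1 : ∀ s ∈ Ico 0 r, HasDerivWithinAt (fun s ↦ u s ^ 2 * Real.exp (2 * K * s))
        (2 * (c s + K) * u s ^ 2 * Real.exp (2 * K * s)) (Ici 0) s := by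
      intro s hs
      have h2 : HasDerivWithinAt (fun s ↦ Real.exp (2 * K * s)) (Real.exp (2 * K * s) * (2 * K * 1)) (Ici 0) s :=
        (((hasDerivAt_id s).const_mul (2 * K)).exp).hasDerivWithinAt
      refine (((hu s (hsub hs)).pow 2).mul h2).congr_deriv ?_
      simp
      ring
    have h2 := monotone_of_hasDerivWithinAt_nonneg h1 (fun s hs ↦ ?_) ⟨ht.1, htr⟩
    · simp only [hut] at h2
      have : 0 < u 0 ^ 2 * Real.exp (2 * K * 0) := by positivity
      linarith
    · have h3 := abs_le.1 (hK s ⟨hs.1, hs.2.le⟩)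
      have : 0 ≤ c s + K := by linarith [h3.1]
      positivity
  by_contra hlt
  have hsub : Icc 0 t ⊆ Ico 0 T := fun s hs ↦ ⟨hs.1, hs.2.trans_lt ht.2⟩
  obtain ⟨s, hs, hs0⟩ := intermediate_value_Icc' ht.1 (fun s hs ↦
    (hu s (hsub hs)).continuousWithinAt.mono Icc_subset_Ici_self : ContinuousOn u (Icc 0 t))
    ⟨not_lt.1 hlt, h0.le⟩
  exact hne s (hsub hs) hs0

end Comparison

/-! ### Ricci flow of diagonal metrics and its life span -/

section Flow

/-- The Ricci flow on left-invariant diagonal metrics. -/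
def flowField (a : Fin 3 → ℝ) (i : Fin 3) : ℝ := -2 * ricciCoeff a i

/-- The coefficients of diagonal metrics. -/
def posCone : Set (Fin 3 → ℝ) := {a | ∀ i, 0 < a i}

theorem isOpen_posCone : IsOpen posCone := by
  have : posCone = Set.pi univ fun _ : Fin 3 ↦ Ioi (0 : ℝ) := by
    ext a
    simp [posCone]
  rw [this]
  exact isOpen_set_pi finite_univ fun _ _ ↦ isOpen_Ioi

theorem contDiffOn_flowField {n : ℕ∞ω} : ContDiffOn ℝ n flowField posCone := by
  have hp : ∀ i, ContDiffOn ℝ n (fun a : Fin 3 → ℝ ↦ a i) posCone := fun i ↦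
    (contDiff_apply ℝ ℝ i).contDiffOn
  have key : ∀ i j k : Fin 3, ContDiffOn ℝ n
      (fun a : Fin 3 → ℝ ↦ -2 * (2 * (a i ^ 2 - (a j - a k) ^ 2) / (a j * a k))) posCone := fun i j k ↦
    contDiffOn_const.mul ((contDiffOn_const.mul (((hp i).pow 2).sub (((hp j).sub (hp k)).pow 2))).div
      ((hp j).mul (hp k)) fun a ha ↦ (mul_pos (ha j) (ha k)).ne')
  rw [contDiffOn_pi]
  intro i
  fin_cases i
  exacts [key 0 1 2, key 1 2 0, key 2 0 1]

/-- The diagonal metric with coefficients `a`, or the round metric if `a` is not positive. -/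
def diagMetricOrRound (a : Fin 3 → ℝ) : SmoothMetric (𝓡 3) S3 :=
  open scoped Classical in
  if h : ∀ i, 0 < a i then diagMetric a h else diagMetric 1 fun _ ↦ one_pos

theorem diagMetricOrRound_of_pos {a : Fin 3 → ℝ} (h : ∀ i, 0 < a i) :
    diagMetricOrRound a = diagMetric a h := dif_pos h

theorem diagMetricOrRound_inner {a : Fin 3 → ℝ} (h : a ∈ posCone) (x : S3)
    (v w : TangentSpace (𝓡 3) x) :
    (diagMetricOrRound a).inner x v w = ∑ i, a i * (coframe x i v * coframe x i w) := by
  rw [diagMetricOrRound_of_pos fun i ↦ h i, diagMetric_inner]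

theorem isLeftInvariant_diagMetricOrRound (a : Fin 3 → ℝ) : IsLeftInvariant (diagMetricOrRound a) := by
  unfold diagMetricOrRound
  split_ifs with h
  exacts [isLeftInvariant_diagMetric a h, isLeftInvariant_diagMetric _ _]

variable {a : ℝ → Fin 3 → ℝ} {T : ℝ}

theorem isRicciFlow_of_isSolutionOn (ha : IsSolutionOn flowField posCone a T) :
    IsRicciFlow (fun t ↦ diagMetricOrRound (a t)) T where
  smooth X Y hX hY := by
    have h1 : ContDiffOn ℝ ∞ a (Ico 0 T) := ha.contDiffOn contDiffOn_flowField
    rw [contDiffOn_pi] at h1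
    have h2 : ∀ i, ContMDiffOn (𝓘(ℝ, ℝ).prod (𝓡 3)) 𝓘(ℝ, ℝ) ∞ (fun p : ℝ × S3 ↦ a p.1 i)
        (Ico 0 T ×ˢ univ) := fun i ↦
      (h1 i).contMDiffOn.comp contMDiffOn_fst fun p hp ↦ hp.1
    have h3 : ∀ i, ContMDiff (𝓡 3) 𝓘(ℝ, ℝ) ∞ (fun x : S3 ↦ coframe x i (X x)) := fun i x ↦
      contMDiffAt_coframe_apply hX.contMDiffAt i
    have h4 : ∀ i, ContMDiff (𝓡 3) 𝓘(ℝ, ℝ) ∞ (fun x : S3 ↦ coframe x i (Y x)) := fun i x ↦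
      contMDiffAt_coframe_apply hY.contMDiffAt i
    have h5 : ContMDiffOn (𝓘(ℝ, ℝ).prod (𝓡 3)) 𝓘(ℝ, ℝ) ∞
        (fun p : ℝ × S3 ↦ ∑ i, a p.1 i * (coframe p.2 i (X p.2) * coframe p.2 i (Y p.2)))
        (Ico 0 T ×ˢ univ) := by
      refine contMDiffOn_finsetSum fun i _ ↦ (h2 i).mul ?_
      exact (((h3 i).mul (h4 i)).comp contMDiff_snd).contMDiffOn
    exact h5.congr fun p hp ↦ diagMetricOrRound_inner (ha.mem p.1 hp.1) p.2 _ _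
  evolution t ht x v w := by
    have h1 : ∀ s ∈ Ico 0 T, (diagMetricOrRound (a s)).inner x v w =
        ∑ i, a s i * (coframe x i v * coframe x i w) := fun s hs ↦
      diagMetricOrRound_inner (ha.mem s hs) x v w
    have h2 := fun i ↦ (hasDerivWithinAt_pi.1 ((ha.hasDeriv t ht).mono (Ico_subset_Ici_self : Ico 0 T ⊆ Ici 0))) i
    have h3 := HasDerivWithinAt.fun_sum (u := Finset.univ) fun i _ ↦
      (h2 i).mul_const (coframe x i v * coframe x i w)
    refine (h3.congr h1 (h1 t ht)).congr_deriv ?_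
    rw [diagMetricOrRound_of_pos fun i ↦ ha.mem t ht i, ricci_diagMetric, Finset.mul_sum]
    refine Finset.sum_congr rfl fun i _ ↦ ?_
    simp only [flowField, comps]
    ring

/-- A longer Ricci flow need not be diagonal after `T`, and no uniqueness of Ricci flow is used. Its
values on the frame vectors at the identity are continuous at `T` and positive, so `a` has a limit
in the open cone and the ODE solution would extend. -/
theorem hasExtinctionTime_of_isSolutionOn (hT : 0 < T) (ha : IsSolutionOn flowField posCone a T)
    (hmax : ∀ T' > T, ∀ b : ℝ → Fin 3 → ℝ, b 0 = a 0 → ¬ IsSolutionOn flowField posCone b T') :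
    HasExtinctionTime (fun t ↦ diagMetricOrRound (a t)) T where
  pos := hT
  flow := isRicciFlow_of_isSolutionOn ha
  maximal := by
    rintro ⟨T', hT', g, hg, hga⟩
    let y : Fin 3 → ℝ := fun i ↦ (g T).inner 1 (frame i 1) (frame i 1)
    have hy : y ∈ posCone := by
      intro i
      refine (g T).pos 1 (frame i 1) fun h ↦ ?_
      have := coframe_frame 1 i i
      rw [h, map_zero, if_pos rfl] at this
      exact zero_ne_one this
    have hlim : Tendsto a (𝓝[<] T) (𝓝 y) := by
      rw [tendsto_pi_nhds]
      intro i
      have h1 := (hg.evolution T ⟨hT.le, hT'⟩ 1 (frame i 1) (frame i 1)).continuousWithinAt.continuousAt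
        (Ico_mem_nhds hT hT')
      refine (h1.tendsto.mono_left nhdsWithin_le_nhds).congr' ?_
      filter_upwards [Ico_mem_nhdsLT hT] with t ht
      rw [hga t ht, diagMetricOrRound_inner (ha.mem t ht)]
      simp [coframe_frame]
    obtain ⟨T'', hT'', b, hb0, hb⟩ :=
      ha.exists_extension isOpen_posCone contDiffOn_flowField hT hy hlim
    exact hmax T'' hT'' b hb0 hb

theorem IsSolutionOn.hasDerivWithinAt_apply (ha : IsSolutionOn flowField posCone a T) {t : ℝ}
    (ht : t ∈ Ico 0 T) (i : Fin 3) :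
    HasDerivWithinAt (fun s ↦ a s i) (flowField (a t) i) (Ici 0) t :=
  hasDerivWithinAt_pi.1 (ha.hasDeriv t ht) i

theorem IsSolutionOn.continuousOn_apply (ha : IsSolutionOn flowField posCone a T) (i : Fin 3) :
    ContinuousOn (fun s ↦ a s i) (Ico 0 T) :=
  continuousOn_pi.1 ha.continuousOn i

/-- The ODE is symmetric under exchanging the two coefficients, so their difference satisfies a
linear equation `u' = c u` and keeps its sign. -/
theorem IsSolutionOn.lt_one_zero (ha : IsSolutionOn flowField posCone a T) (h : a 0 1 < a 0 0)
    {t : ℝ} (ht : t ∈ Ico 0 T) : a t 1 < a t 0 := by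
  have hc := ha.continuousOn_apply
  refine sub_pos.1 (pos_of_hasDerivWithinAt_mul (u := fun t ↦ a t 0 - a t 1)
    (c := fun t ↦ -4 * ((a t 0 + a t 1) ^ 2 - a t 2 ^ 2) / (a t 0 * a t 1 * a t 2)) (fun t ht ↦ ?_)
    ?_ (sub_pos.2 h) ht)
  · refine ((ha.hasDerivWithinAt_apply ht 0).sub (ha.hasDerivWithinAt_apply ht 1)).congr_deriv ?_
    have h0 := (ha.mem t ht 0).ne'
    have h1 := (ha.mem t ht 1).ne'
    have h2 := (ha.mem t ht 2).ne'
    simp [flowField, ricciCoeff]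
    field_simp
    ring
  · exact (continuousOn_const.mul ((((hc 0).add (hc 1)).pow 2).sub ((hc 2).pow 2))).div
      (((hc 0).mul (hc 1)).mul (hc 2)) fun t ht ↦
        (mul_pos (mul_pos (ha.mem t ht 0) (ha.mem t ht 1)) (ha.mem t ht 2)).ne'

theorem IsSolutionOn.lt_two_one (ha : IsSolutionOn flowField posCone a T) (h : a 0 2 < a 0 1)
    {t : ℝ} (ht : t ∈ Ico 0 T) : a t 2 < a t 1 := by
  have hc := ha.continuousOn_apply
  refine sub_pos.1 (pos_of_hasDerivWithinAt_mul (u := fun t ↦ a t 1 - a t 2)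
    (c := fun t ↦ -4 * ((a t 1 + a t 2) ^ 2 - a t 0 ^ 2) / (a t 0 * a t 1 * a t 2)) (fun t ht ↦ ?_)
    ?_ (sub_pos.2 h) ht)
  · refine ((ha.hasDerivWithinAt_apply ht 1).sub (ha.hasDerivWithinAt_apply ht 2)).congr_deriv ?_
    have h0 := (ha.mem t ht 0).ne'
    have h1 := (ha.mem t ht 1).ne'
    have h2 := (ha.mem t ht 2).ne'
    simp [flowField, ricciCoeff]
    field_simp
    ring
  · exact (continuousOn_const.mul ((((hc 1).add (hc 2)).pow 2).sub ((hc 0).pow 2))).div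
      (((hc 0).mul (hc 1)).mul (hc 2)) fun t ht ↦
        (mul_pos (mul_pos (ha.mem t ht 0) (ha.mem t ht 1)) (ha.mem t ht 2)).ne'

/-- From `x₀ > x₁ > x₂` one has `x₀² - (x₁ - x₂)² ≥ 2x₁x₂ - x₂² ≥ x₁x₂`. -/
theorem flowField_zero_le {x : Fin 3 → ℝ} (hx : x ∈ posCone) (h1 : x 1 < x 0) (h2 : x 2 < x 1) :
    flowField x 0 ≤ -4 := by
  have h3 := hx 1
  have h4 := hx 2
  have : 2 ≤ ricciCoeff x 0 := by
    change 2 ≤ 2 * (x 0 ^ 2 - (x 1 - x 2) ^ 2) / (x 1 * x 2)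
    rw [le_div_iff₀ (mul_pos h3 h4)]
    nlinarith
  simp only [flowField]
  linarith

/-- The needed inequality `x₁² - (x₂ - x₀)² ≤ 2x₀x₂` amounts to `x₁² ≤ x₀² + x₂²`. The bound does
not involve the size of `x₂`, so collapse of that direction does no harm. -/
theorem le_flowField_one {x : Fin 3 → ℝ} (hx : x ∈ posCone) (h1 : x 1 < x 0) :
    -8 ≤ flowField x 1 := by
  have h0 := hx 0
  have h3 := hx 1
  have h4 := hx 2
  have : ricciCoeff x 1 ≤ 4 := by
    change 2 * (x 1 ^ 2 - (x 2 - x 0) ^ 2) / (x 2 * x 0) ≤ 4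
    rw [div_le_iff₀ (mul_pos h4 h0)]
    nlinarith
  simp only [flowField]
  linarith

/-- After dropping the square, the Ricci coefficient is at most `2x₂²/(x₀x₁)`, and `x₂ b ≤ x₀ x₁`. A
bound linear in `x₂` rules out its vanishing in finite time. -/
theorem le_flowField_two {x : Fin 3 → ℝ} (hx : x ∈ posCone) (h1 : x 1 < x 0) (h2 : x 2 < x 1) {b : ℝ}
    (hb : 0 < b) (hbx : b ≤ x 1) : -(4 / b) * x 2 ≤ flowField x 2 := by
  have h0 := hx 0
  have h3 := hx 1
  have h4 := hx 2
  have : ricciCoeff x 2 ≤ 2 / b * x 2 := by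
    change 2 * (x 2 ^ 2 - (x 0 - x 1) ^ 2) / (x 0 * x 1) ≤ _
    rw [div_le_iff₀ (mul_pos h0 h3), div_mul_eq_mul_div, div_mul_eq_mul_div, le_div_iff₀ hb]
    have h5 : x 2 * b ≤ x 0 * x 1 := mul_le_mul (by linarith) hbx hb.le h0.le
    nlinarith [mul_nonneg hb.le (sq_nonneg (x 0 - x 1)), mul_le_mul_of_nonneg_left h5 h4.le]
  simp only [flowField]
  rw [show -(4 / b) * x 2 = -2 * (2 / b * x 2) by ring]
  linarith

theorem IsSolutionOn.apply_zero_le (ha : IsSolutionOn flowField posCone a T) (h1 : a 0 1 < a 0 0)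
    (h2 : a 0 2 < a 0 1) {t : ℝ} (ht : t ∈ Ico 0 T) : a t 0 ≤ a 0 0 - 4 * t := by
  have h := monotone_of_hasDerivWithinAt_nonneg (u := fun t ↦ -a t 0 + -4 * t) (fun t ht ↦
    (ha.hasDerivWithinAt_apply ht 0).neg.add
      (((hasDerivAt_id t).const_mul (-4)).hasDerivWithinAt)) (fun t ht ↦ ?_) ht
  · linarith
  · have := flowField_zero_le (ha.mem t ht) (ha.lt_one_zero h1 ht) (ha.lt_two_one h2 ht)
    linarith

theorem IsSolutionOn.le_apply_one (ha : IsSolutionOn flowField posCone a T) (h1 : a 0 1 < a 0 0)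
    {t : ℝ} (ht : t ∈ Ico 0 T) : a 0 1 - 8 * t ≤ a t 1 := by
  have h := monotone_of_hasDerivWithinAt_nonneg (u := fun t ↦ a t 1 + 8 * t) (fun t ht ↦
    (ha.hasDerivWithinAt_apply ht 1).add
      (((hasDerivAt_id t).const_mul 8).hasDerivWithinAt)) (fun t ht ↦ ?_) ht
  · linarith
  · have := le_flowField_one (ha.mem t ht) (ha.lt_one_zero h1 ht)
    linarith

theorem IsSolutionOn.le_apply_two (ha : IsSolutionOn flowField posCone a T) (h1 : a 0 1 < a 0 0)
    (h2 : a 0 2 < a 0 1) {b : ℝ} (hb : 0 < b) (hab : ∀ t ∈ Ico 0 T, b ≤ a t 1) {t : ℝ}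
    (ht : t ∈ Ico 0 T) : a 0 2 ≤ a t 2 * Real.exp (4 / b * t) := by
  have h := monotone_of_hasDerivWithinAt_nonneg (u := fun t ↦ a t 2 * Real.exp (4 / b * t)) (fun t ht ↦
    (ha.hasDerivWithinAt_apply ht 2).mul
      (((hasDerivAt_id t).const_mul (4 / b)).exp.hasDerivWithinAt)) (fun t ht ↦ ?_) ht
  · simpa using h
  · have h3 := le_flowField_two (ha.mem t ht) (ha.lt_one_zero h1 ht) (ha.lt_two_one h2 ht) hb (hab t ht)
    have h4 := Real.exp_pos (4 / b * t)
    simp only [id_eq, mul_one]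
    nlinarith

theorem IsSolutionOn.le_lifespan (ha : IsSolutionOn flowField posCone a T) (hT : 0 < T)
    (h1 : a 0 1 < a 0 0) (h2 : a 0 2 < a 0 1)
    (hmax : ∀ T' > T, ∀ b : ℝ → Fin 3 → ℝ, b 0 = a 0 → ¬ IsSolutionOn flowField posCone b T') :
    a 0 1 / 8 ≤ T := by
  by_contra! hlt
  let b := a 0 1 - 8 * T
  have hb : 0 < b := by
    simp only [b]
    linarith
  have hab : ∀ t ∈ Ico 0 T, b ≤ a t 1 := fun t ht ↦ by
    have := ha.le_apply_one h1 ht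
    simp only [b]
    linarith [ht.2]
  -- Lower bound for the smallest coefficient; with the upper bound `a 0 0` for the largest it
  -- confines the solution to the compact cube `K`.
  let c := a 0 2 * Real.exp (-(4 / b * T))
  have hc : 0 < c := mul_pos (ha.mem 0 ⟨le_rfl, hT⟩ 2) (Real.exp_pos _)
  have hac : ∀ t ∈ Ico 0 T, c ≤ a t 2 := fun t ht ↦ by
    have h3 := ha.le_apply_two h1 h2 hb hab ht
    have h4 : Real.exp (4 / b * t) ≤ Real.exp (4 / b * T) :=
      Real.exp_le_exp.2 (mul_le_mul_of_nonneg_left ht.2.le (by positivity))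
    have h5 := h3.trans (mul_le_mul_of_nonneg_left h4 (ha.mem t ht 2).le)
    simp only [c, Real.exp_neg]
    rwa [← div_eq_mul_inv, div_le_iff₀ (Real.exp_pos _)]
  let K : Set (Fin 3 → ℝ) := Set.pi univ fun _ ↦ Icc c (a 0 0)
  have hK : IsCompact K := isCompact_univ_pi fun _ ↦ isCompact_Icc
  have hKU : K ⊆ posCone := fun x hx i ↦ hc.trans_le (hx i trivial).1
  have haK : ∀ t ∈ Ico 0 T, a t ∈ K := by
    intro t ht i _
    have h3 := ha.lt_one_zero h1 ht
    have h4 := ha.lt_two_one h2 ht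
    have h5 := hac t ht
    have h6 := ha.apply_zero_le h1 h2 ht
    have h7 := ht.1
    fin_cases i
    · exact ⟨by simp only [Fin.zero_eta]; linarith, by simp only [Fin.zero_eta]; linarith⟩
    · exact ⟨by simp only [Fin.mk_one]; linarith, by simp only [Fin.mk_one]; linarith⟩
    · exact ⟨by simp only [Fin.reduceFinMk]; linarith, by simp only [Fin.reduceFinMk]; linarith⟩
  obtain ⟨M, hM⟩ := hK.exists_bound_of_continuousOn
    ((contDiffOn_flowField (n := 0)).continuousOn.mono hKU)
  -- Bounded velocity gives a Lipschitz curve, whose extension to the whole line supplies the limit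
  -- at `T`.
  have hlip : LipschitzOnWith M.toNNReal a (Ico 0 T) :=
    (convex_Ico 0 T).lipschitzOnWith_of_nnnorm_hasDerivWithin_le
      (fun t ht ↦ (ha.hasDeriv t ht).mono Ico_subset_Ici_self) fun t ht ↦ by
        rw [← NNReal.coe_le_coe, coe_nnnorm]
        exact (hM _ (haK t ht)).trans (Real.le_coe_toNNReal M)
  obtain ⟨α, hα, hαa⟩ := hlip.extend_pi
  have hlim : Tendsto a (𝓝[<] T) (𝓝 (α T)) := by
    refine (hα.continuous.continuousAt.tendsto.mono_left nhdsWithin_le_nhds).congr' ?_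
    filter_upwards [Ico_mem_nhdsLT hT] with t ht using (hαa ht).symm
  have hαK : α T ∈ K := hK.isClosed.mem_of_tendsto hlim (by
    filter_upwards [Ico_mem_nhdsLT hT] with t ht using haK t ht)
  obtain ⟨T', hT', β, hβ0, hβ⟩ :=
    ha.exists_extension isOpen_posCone contDiffOn_flowField hT (hKU hαK) hlim
  exact hmax T' hT' β hβ0 hβ

theorem IsSolutionOn.lifespan_le (ha : IsSolutionOn flowField posCone a T) (hT : 0 < T)
    (h1 : a 0 1 < a 0 0) (h2 : a 0 2 < a 0 1) : T ≤ a 0 0 / 4 := by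
  refine le_of_forall_lt fun t ht ↦ ?_
  rcases le_or_gt 0 t with h0 | h0
  · have h3 := ha.apply_zero_le h1 h2 ⟨h0, ht⟩
    have h4 := ha.mem t ⟨h0, ht⟩ 0
    linarith
  · have := ha.mem 0 ⟨le_rfl, hT⟩ 0
    linarith

theorem exists_flow {p : Fin 3 → ℝ} (hp : p ∈ posCone) (h1 : p 1 < p 0) (h2 : p 2 < p 1) :
    ∃ (T : ℝ) (a : ℝ → Fin 3 → ℝ), p 1 / 8 ≤ T ∧ a 0 = p ∧
      HasExtinctionTime (fun t ↦ diagMetricOrRound (a t)) T := by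
  obtain ⟨T, hT, a, ha0, ha, hmax⟩ := exists_maximal_isSolutionOn isOpen_posCone contDiffOn_flowField hp
    (L := p 0 / 4) fun T a hT ha0 ha ↦ by
      subst ha0
      exact ha.lifespan_le hT h1 h2
  subst ha0
  exact ⟨T, a, ha.le_lifespan hT h1 h2 hmax, rfl, hasExtinctionTime_of_isSolutionOn hT ha hmax⟩

end Flow

/-! ### Initial metrics with unit curvature and large coefficients -/

section InitialData

theorem sum_ricciCoeff_div {a : Fin 3 → ℝ} (ha : ∀ i, 0 < a i) :
    ∑ i, ricciCoeff a i / a i = 2 * (2 * (a 0 * a 1 + a 1 * a 2 + a 2 * a 0) - a 0 ^ 2 - a 1 ^ 2 - a 2 ^ 2) /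
      (a 0 * a 1 * a 2) := by
  have h0 := (ha 0).ne'
  have h1 := (ha 1).ne'
  have h2 := (ha 2).ne'
  simp [Fin.sum_univ_three, ricciCoeff]
  field_simp
  ring

/-- The gap `ε` and the thin direction `ε²` are balanced. In `le_curvNorm` the numerator is about
`4ε` and the denominator about `ε²`. In the scalar curvature the negative term `(a₀ - a₁)² = ε²`
loses against `2a₂(a₀ + a₁)`, about `4ε²`. Multiplying by the curvature norm `ρ ≥ 1/ε` normalizes
`‖Rm‖` and makes the middle coefficient equal to `ρ`. -/
theorem exists_initialData {ε : ℝ} (hε : 0 < ε) (hε1 : ε ≤ 1 / 2) :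
    ∃ p ∈ posCone, p 1 < p 0 ∧ p 2 < p 1 ∧ 1 / ε ≤ p 1 ∧ curvNorm p = 1 ∧
      0 < ∑ i, ricciCoeff p i / p i := by
  let q : Fin 3 → ℝ := ![1 + ε, 1, ε ^ 2]
  have hq : ∀ i, 0 < q i := by
    intro i
    fin_cases i
    · change 0 < 1 + ε
      linarith
    · exact one_pos
    · change 0 < ε ^ 2
      positivity
  have hρ : 1 / ε ≤ curvNorm q := by
    refine le_trans ?_ (le_curvNorm hq)
    change 1 / ε ≤ ((1 + ε) ^ 2 - 3 * 1 ^ 2 + 2 * 1 * ε ^ 2 + 2 * (1 + ε) * 1 - 2 * (1 + ε) * ε ^ 2 +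
      (ε ^ 2) ^ 2) / ((1 + ε) * 1 * ε ^ 2)
    rw [div_le_div_iff₀ hε (by positivity)]
    nlinarith [pow_pos hε 2, pow_pos hε 3, pow_pos hε 4, pow_pos hε 5,
      mul_nonneg (pow_pos hε 2).le (sub_nonneg.2 hε1), mul_nonneg (pow_pos hε 3).le (sub_nonneg.2 hε1)]
  have hρ0 : 0 < curvNorm q := (one_div_pos.2 hε).trans_le hρ
  set ρ := curvNorm q with hρdef
  have hp : ∀ i, 0 < (ρ • q) i := fun i ↦ mul_pos hρ0 (hq i)
  have h0 : (ρ • q) 0 = ρ * (1 + ε) := rfl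
  have h1 : (ρ • q) 1 = ρ * 1 := rfl
  have h2 : (ρ • q) 2 = ρ * ε ^ 2 := rfl
  refine ⟨ρ • q, hp, ?_, ?_, ?_, ?_, ?_⟩
  · rw [h0, h1]
    nlinarith
  · rw [h1, h2]
    refine mul_lt_mul_of_pos_left ?_ hρ0
    nlinarith
  · rwa [h1, mul_one]
  · rw [curvNorm_smul hρ0, ← hρdef, inv_mul_cancel₀ hρ0.ne']
  · rw [sum_ricciCoeff_div hp]
    refine div_pos ?_ (mul_pos (mul_pos (hp 0) (hp 1)) (hp 2))
    rw [h0, h1, h2, show 2 * (2 * (ρ * (1 + ε) * (ρ * 1) + ρ * 1 * (ρ * ε ^ 2) + ρ * ε ^ 2 * (ρ * (1 + ε))) -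
      (ρ * (1 + ε)) ^ 2 - (ρ * 1) ^ 2 - (ρ * ε ^ 2) ^ 2) =
        2 * (ρ ^ 2 * ε ^ 2) * (3 + 2 * ε - ε ^ 2) by ring]
    have : 0 < 3 + 2 * ε - ε ^ 2 := by nlinarith
    positivity

end InitialData

theorem exists_flow_of_large_lifespan (l : ℕ) :
    ∃ (T : ℝ) (g : ℝ → SmoothMetric (𝓡 3) S3), (l : ℝ) / 8 ≤ T ∧ HasExtinctionTime g T ∧
      (∀ t, IsHomogeneous (g t) ∧ IsLeftInvariant (g t)) ∧
      (∀ x, normRm (g 0) x = 1) ∧ ∀ x, 0 < scal (g 0) x := by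
  have hl : (0 : ℝ) ≤ l := l.cast_nonneg
  -- The shift by `2` ensures `ε ≤ 1/2` for every `l`, including `0`, and gives `p 1 ≥ l + 2`.
  obtain ⟨p, hp, h1, h2, hle, hnorm, hscal⟩ := exists_initialData (ε := 1 / ((l : ℝ) + 2))
    (by positivity) (one_div_le_one_div_of_le two_pos (by linarith))
  obtain ⟨T, a, hT, ha0, hflow⟩ := exists_flow hp h1 h2
  rw [one_div_one_div] at hle
  refine ⟨T, fun t ↦ diagMetricOrRound (a t), by linarith, hflow, fun t ↦ ?_, fun x ↦ ?_, fun x ↦ ?_⟩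
  · have h := isLeftInvariant_diagMetricOrRound (a t)
    exact ⟨h.isHomogeneous, h⟩
  · beta_reduce
    rw [ha0, diagMetricOrRound_of_pos fun i ↦ hp i, normRm_diagMetric, hnorm]
  · beta_reduce
    rw [ha0, diagMetricOrRound_of_pos fun i ↦ hp i, scal_diagMetric]
    exact hscal
end

theorem mainTheorem7 :
    (∃ (T : ℕ → ℝ) (g : ℕ → ℝ → SmoothMetric (𝓡 3) S3),
      (∀ l, HasExtinctionTime (g l) (T l)) ∧
      (∀ l, ∀ t ∈ Ico 0 (T l), IsHomogeneous (g l t) ∧ IsLeftInvariant (g l t)) ∧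
      (∀ l x, normRm (g l 0) x = 1) ∧
      (∀ l x, 0 < scal (g l 0) x) ∧
      Tendsto T atTop atTop) ∧
    (∀ δ ∈ Ioo (0 : ℝ) 1, ¬ ∃ C : ℝ, ∀ (T : ℝ) (g : ℝ → SmoothMetric (𝓡 3) S3),
      HasExtinctionTime g T → (∀ t ∈ Ico 0 T, IsHomogeneous (g t)) →
      (∀ x, 0 < scal (g 0) x) →
      ∀ t ∈ Ico 0 (δ * T), ∀ x, normRm (g t) x * (T - t) ≤ C) := by
  choose T g hT hext hinv hnorm hscal using exists_flow_of_large_lifespan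
  refine ⟨⟨T, g, hext, fun l t _ ↦ hinv l t, hnorm, hscal, ?_⟩, ?_⟩
  · exact tendsto_atTop_mono hT (tendsto_natCast_atTop_atTop.atTop_div_const (by norm_num))
  · rintro δ hδ ⟨C, hC⟩
    -- At `t = 0` the curvature norm is `1`, so the supposed bound reads `T l ≤ C`, against `T l ≥
    -- l/8 > C`.
    obtain ⟨l, hl⟩ := exists_nat_gt (8 * C)
    have h := hC (T l) (g l) (hext l) (fun t _ ↦ (hinv l t).1) (hscal l) 0
      ⟨le_rfl, mul_pos hδ.1 (hext l).pos⟩ 1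
    rw [hnorm, one_mul, sub_zero] at h
    linarith [hT l]
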